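/- Let $\mathfrak g$ be a real vector space of dimension $n$ and let $\Gamma$ be a finite simple $d$-valent graph with vertex set $V_\Gamma$. An axial function $\alpha$ assigns to each pair $(p,e)$, $p$ a vertex and $e$ an edge containing $p$, a vector $\alpha_{p,e}\in\mathfrak g^*\setminus\{0\}$ such that (a) $\alpha_{p,e}=-\alpha_{q,e}$ if $e$ joins $p$ and $q$; (b) for each vertex $p$ the vectors $\alpha_{p,e}$ are pairwise linearly independent; (c) if $e$ joins $p$ and $q$, and $\mathfrak g_e=\ker\alpha_{p,e}$, there is a bijection from the edges at $p$ to the edges at $q$ that maps $e$ to $e$ and is such that $\alpha_{p,e_i}$ and $\alpha_{q,e_i'}$ have the same restriction to $\mathfrak g_e$ whenever $e_i\mapsto e_i'$. Let $H^{2k}(\Gamma,\alpha)$ be the space of maps $f:V_\Gamma\to S^k(\mathfrak g^*)$ such that $f(p)$ and $f(q)$ have the same image in $S^k(\mathfrak g_e^*)$ for each edge $e$ joining $p$ and $q$. Let $\mathcal P$ be the set of $\xi\in\mathfrak g$ with $\alpha_{p,e}(\xi)\ne0$ for all $(p,e)$; each $\xi\in\mathcal P$ orients each edge $e$ with vertices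 $p,q$ from $p$ to $q$ if $\alpha_{p,e}(\xi)>0$. The no-cycle condition says that for at least one $\xi\in\mathcal P$ this orientation has no oriented cycles. For $\xi\in\mathcal P$ the Betti number $\beta_r$ is the number of vertices $p$ for which exactly $r$ edges $e$ at $p$ have $\alpha_{p,e}(\xi)<0$. For a subspace $\mathfrak h\subseteq\mathfrak g$ let $\Gamma_{\mathfrak h}$ be the subgraph of $\Gamma$ whose edges are the edges $e$ of $\Gamma$ with $\alpha_{p,e}|_{\mathfrak h}=0$; the Betti numbers of its connected components are defined in the same way, using the restriction of $\alpha$. A family of vectors is called $l$-independent if any subfamily with at most $l$ members is linearly independent. Theorem. Assume that $(\Gamma,\alpha)$ satisfies the no-cycle condition. Let $l\ge 0$ be an integer, let all Betti numbers be computed with an arbitrary fixed $\xi\in\mathcal P$ (not necessarily one for which the orientation has no cycles), and suppose that 1. for every subspace $\mathfrak h$ of $\mathfrak g$ of codimension strictly less than $l$, every connected component of $\Gamma_{\mathfrak h}$ has zeroth Betti number $1$; 2. for every vertex $p$ of $\Gamma$ the vectors $\alpha_{p,e}$, $e$ ranging over the edges containing $p$, are $l$-independent. Then, as $k\to\infty$,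 $$\dim H^{2k}(\Gamma,\alpha)=\sum_{r}\beta_r\,\dim S^{k-r}(\mathfrak g^*)+O(k^{\,n-1-l}),$$ where $S^{j}(\mathfrak g^*)=0$ for $j<0$. -/

import Mathlib

open Filter Asymptotics

namespace GraphAxial

noncomputable section

universe u v

variable {V : Type u} {g : Type v} [AddCommGroup g] [Module ℝ g]

/-- The oriented edges of `G` issuing from `p`. They correspond to the edges containing `p`, that is
to the pairs `(p, e)` of the incidence relation with first entry `p`. -/
abbrev OutEdges (G : SimpleGraph V) (p : V) : Type u := {d : G.Dart // d.fst = p}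

/-- The restriction map `g* → h*`, the transpose of the inclusion of a subspace `h` of `g`. -/
def restrictDual (h : Submodule ℝ g) : Module.Dual ℝ g →ₗ[ℝ] Module.Dual ℝ h :=
  h.subtype.dualMap

/-- The ring morphism `S(g*) → S(h*)` extending the restriction map `g* → h*`. -/
def restrictSym (h : Submodule ℝ g) :
    SymmetricAlgebra ℝ (Module.Dual ℝ g) →ₐ[ℝ] SymmetricAlgebra ℝ (Module.Dual ℝ h) :=
  SymmetricAlgebra.lift (SymmetricAlgebra.ι ℝ (Module.Dual ℝ h) ∘ₗ restrictDual h)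

/-- The `k`-th symmetric power `S^k(g*)`, as the degree `k` part of `S(g*)`: the span of the
products of `k` elements of `g*`. -/
def symPow (g : Type v) [AddCommGroup g] [Module ℝ g] (k : ℕ) :
    Submodule ℝ (SymmetricAlgebra ℝ (Module.Dual ℝ g)) :=
  LinearMap.range (SymmetricAlgebra.ι ℝ (Module.Dual ℝ g)) ^ k

/-- `α` is an axial function on `G`. The value `α_{p,e}` is `α d`, where `d` is the edge `e`
oriented so that it issues from `p`. -/
structure IsAxialFunction (G : SimpleGraph V) (α : G.Dart → Module.Dual ℝ g) : Prop where
  ne_zero : ∀ d, α d ≠ 0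
  symm : ∀ d, α d.symm = -α d
  pairwise_independent : ∀ d d' : G.Dart, d.fst = d'.fst → d ≠ d' →
    LinearIndependent ℝ ![α d, α d']
  /-- The edges at the two ends of an edge can be matched so that the edge is matched with itself
  and matching values of `α` have the same restriction to the annihilator of `α d`. -/
  compatible : ∀ d : G.Dart, ∃ θ : OutEdges G d.fst ≃ OutEdges G d.snd,
    θ ⟨d, rfl⟩ = ⟨d.symm, rfl⟩ ∧
    ∀ x : OutEdges G d.fst,
      restrictDual (LinearMap.ker (α d)) (α x.1) =
        restrictDual (LinearMap.ker (α d)) (α (θ x).1)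

/-- `H^{2k}(Γ, α)`: the maps `f : V → S^k(g*)` such that `f(p)` and `f(q)` have the same image in
`S(g_e*)` for each edge `e` joining `p` and `q`, where `g_e = ker α_{p,e}`. -/
def cohomology (G : SimpleGraph V) (α : G.Dart → Module.Dual ℝ g) (k : ℕ) :
    Submodule ℝ (V → SymmetricAlgebra ℝ (Module.Dual ℝ g)) where
  carrier := {f | (∀ p, f p ∈ symPow g k) ∧
    ∀ d : G.Dart, restrictSym (LinearMap.ker (α d)) (f d.fst) =
      restrictSym (LinearMap.ker (α d)) (f d.snd)}
  add_mem' := by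
    rintro a b ⟨ha, ha'⟩ ⟨hb, hb'⟩
    refine ⟨fun p => Submodule.add_mem _ (ha p) (hb p), fun d => ?_⟩
    simp only [Pi.add_apply, map_add, ha' d, hb' d]
  zero_mem' := ⟨fun _ => Submodule.zero_mem _, fun _ => rfl⟩
  smul_mem' := by
    rintro c a ⟨ha, ha'⟩
    refine ⟨fun p => Submodule.smul_mem _ c (ha p), fun d => ?_⟩
    simp only [Pi.smul_apply, map_smul, ha' d]

/-- The set of `ξ ∈ g` on which no `α_{p,e}` vanishes. -/
def generic (G : SimpleGraph V) (α : G.Dart → Module.Dual ℝ g) : Set g :=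
  {ξ | ∀ d, α d ξ ≠ 0}

/-- In the orientation given by `ξ` there is an edge going from `p` up to `q`. -/
def Up (G : SimpleGraph V) (α : G.Dart → Module.Dual ℝ g) (ξ : g) (p q : V) : Prop :=
  ∃ d : G.Dart, d.fst = p ∧ d.snd = q ∧ 0 < α d ξ

/-- For at least one generic `ξ` the oriented graph has no oriented cycles: no vertex is reached
from itself by an oriented path of positive length. -/
def NoCycle (G : SimpleGraph V) (α : G.Dart → Module.Dual ℝ g) : Prop :=
  ∃ ξ ∈ generic G α, ∀ p, ¬ Relation.TransGen (Up G α ξ) p p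

/-- `σ_p(ξ)`: the number of edges `e` at `p` with `α_{p,e}(ξ) < 0`. -/
def index (G : SimpleGraph V) (α : G.Dart → Module.Dual ℝ g) (ξ : g) (p : V) : ℕ :=
  Nat.card {x : OutEdges G p // α x.1 ξ < 0}

/-- The `r`-th Betti number `β_r` computed with `ξ`: the number of vertices `p` with
`σ_p(ξ) = r`. -/
def betti (G : SimpleGraph V) (α : G.Dart → Module.Dual ℝ g) (ξ : g) (r : ℕ) : ℕ :=
  Nat.card {p : V // index G α ξ p = r}

/-- The subgraph `Γ_h`: its edges are the edges `e` of `G`, with vertices `p` and `q`, for which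
`α_{p,e}` and `α_{q,e}` restrict to zero on `h`. -/
def subgraphOf (G : SimpleGraph V) (α : G.Dart → Module.Dual ℝ g) (h : Submodule ℝ g) :
    SimpleGraph V where
  Adj p q := ∃ hpq : G.Adj p q, restrictDual h (α ⟨(p, q), hpq⟩) = 0 ∧
    restrictDual h (α ⟨(q, p), hpq.symm⟩) = 0
  symm := ⟨fun _ _ ⟨hpq, h₁, h₂⟩ => ⟨hpq.symm, h₂, h₁⟩⟩
  loopless := ⟨fun _ ⟨hpp, _⟩ => G.irrefl hpp⟩

theorem subgraphOf_le (G : SimpleGraph V) (α : G.Dart → Module.Dual ℝ g) (h : Submodule ℝ g) :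
    subgraphOf G α h ≤ G :=
  fun _ _ hpq => hpq.1

/-- The inclusion of a connected component of `Γ_h` into the whole graph. -/
def componentHom (G : SimpleGraph V) (α : G.Dart → Module.Dual ℝ g) (h : Submodule ℝ g)
    (C : (subgraphOf G α h).ConnectedComponent) : C.toSimpleGraph →g G :=
  (SimpleGraph.Hom.ofLE (subgraphOf_le G α h)).comp C.toSimpleGraph_hom

/-- The restriction of `α` to the oriented edges of a connected component of `Γ_h`. -/
def componentAxial (G : SimpleGraph V) (α : G.Dart → Module.Dual ℝ g) (h : Submodule ℝ g)
    (C : (subgraphOf G α h).ConnectedComponent) :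
    C.toSimpleGraph.Dart → Module.Dual ℝ g :=
  fun d => α ((componentHom G α h C).mapDart d)

/-- `l`-independence of a family of vectors: any (at most) `l` of them are linearly independent.
For a family with at least `l` members it is enough to consider exactly `l` of them. -/
def LIndependent {ι : Type*} {M : Type*} [AddCommGroup M] [Module ℝ M] (l : ℕ) (w : ι → M) :
    Prop :=
  ∀ s : Finset ι, s.card ≤ l → LinearIndependent ℝ (fun i : s => w i)

end

end GraphAxial

/-! Morse theory on the graph. Fix `ζ` whose orientation has no cycles and write `σ_p` for the index
of `p`. Classes are filtered by support, removing minimal vertices one at a time from an upward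
closed set. A class that vanishes below `p` has a value at `p` that vanishes on the kernel of each
descending weight, hence is divisible by their product (`exists_eq_prod_mul`). So `p` contributes at
most `dim S^{k-σ_p}`, and exactly the dimension of the space of quotients realised by classes
supported on the set. It remains to show that almost all quotients are realised.

Let `B` be a set of fewer than `l` ascending edges at `p`, and `h` the common kernel of their
weights. By `l`-independence the edges of `Γ_h` at `p` are exactly those in `B`, so `p` is a local
minimum of its component `C`. Since the zeroth Betti number of `C` is `1`, all of `C` lies above
`p`. The Thom class of `C` therefore shows that every multiple of the product of the ascending
weights outside `B` is realised (`prod_mul_mem_leadingTerms`). A graded subspace containing these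
multiples for all such `B` has codimension `O(m^{n-1-l})` in degree `m`
(`isBigO_codim_of_prod_mem`), by restriction to a hyperplane and division by its form.

The given `ξ` may be replaced by `ζ`, on the graph and on the components of each `Γ_h`, because
Betti numbers do not change when a wall is crossed (`betti_eq_of_generic`). -/

namespace GraphAxial

noncomputable section

/-! ### Restriction and divisibility in the symmetric algebra -/

section SymmetricPowers

variable {g : Type*} [AddCommGroup g] [Module ℝ g]

/-- A linear form, seen as an element of the symmetric algebra. -/
abbrev linForm (w : Module.Dual ℝ g) : SymmetricAlgebra ℝ (Module.Dual ℝ g) :=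
  SymmetricAlgebra.ι ℝ (Module.Dual ℝ g) w

/-- Evaluation at a vector extends to an algebra morphism `S(g*) → ℝ`, and these morphisms separate
linear forms. -/
theorem linForm_injective : Function.Injective (linForm (g := g)) := by
  intro x y hxy
  have h2 : ∀ v : g, (x : g →ₗ[ℝ] ℝ) v = y v := by
    intro v
    have := congrArg (SymmetricAlgebra.lift (Module.Dual.eval ℝ g v) :
      SymmetricAlgebra ℝ (Module.Dual ℝ g) →ₐ[ℝ] ℝ) hxy
    simpa using this
  exact LinearMap.ext h2

theorem linForm_ne_zero {w : Module.Dual ℝ g} (hw : w ≠ 0) : linForm w ≠ 0 := by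
  intro h
  exact hw (linForm_injective (h.trans (map_zero _).symm))

@[simp]
theorem restrictSym_linForm (h : Submodule ℝ g) (w : Module.Dual ℝ g) :
    restrictSym h (linForm w) = linForm (restrictDual h w) := by
  simp [restrictSym, linForm]

theorem restrictDual_eq_zero_iff {h : Submodule ℝ g} {w : Module.Dual ℝ g} :
    restrictDual h w = 0 ↔ h ≤ LinearMap.ker w := by
  constructor
  · intro H x hx
    exact LinearMap.congr_fun H ⟨x, hx⟩
  · intro H
    ext ⟨x, hx⟩
    exact H hx

theorem one_mem_symPow : (1 : SymmetricAlgebra ℝ (Module.Dual ℝ g)) ∈ symPow g 0 := by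
  rw [symPow, pow_zero]
  exact Submodule.one_le.mp le_rfl

theorem linForm_mem_symPow (w : Module.Dual ℝ g) : linForm w ∈ symPow g 1 := by
  rw [symPow, pow_one]
  exact ⟨w, rfl⟩

theorem mul_mem_symPow {a b : ℕ} {x y : SymmetricAlgebra ℝ (Module.Dual ℝ g)}
    (hx : x ∈ symPow g a) (hy : y ∈ symPow g b) : x * y ∈ symPow g (a + b) := by
  rw [symPow, pow_add]
  exact Submodule.mul_mem_mul hx hy

theorem prod_linForm_mem_symPow {ι : Type*} (s : Finset ι) (w : ι → Module.Dual ℝ g) :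
    ∏ i ∈ s, linForm (w i) ∈ symPow g s.card := by
  classical
  induction s using Finset.induction_on with
  | empty => simpa using one_mem_symPow
  | insert a s ha ih =>
    rw [Finset.prod_insert ha, Finset.card_insert_of_notMem ha, add_comm]
    exact mul_mem_symPow (linForm_mem_symPow _) ih

theorem symPow_succ_induction {k : ℕ} {P : SymmetricAlgebra ℝ (Module.Dual ℝ g) → Prop}
    (mul : ∀ w : Module.Dual ℝ g, ∀ y ∈ symPow g k, P (linForm w * y))
    (add : ∀ x y, P x → P y → P (x + y)) {x : SymmetricAlgebra ℝ (Module.Dual ℝ g)}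
    (hx : x ∈ symPow g (k + 1)) : P x := by
  rw [symPow, pow_succ'] at hx
  refine Submodule.mul_induction_on hx ?_ add
  rintro _ ⟨w, rfl⟩ y hy
  exact mul w y hy

/-- An algebra morphism induced by a linear map of dual spaces preserves degrees. -/
theorem lift_mem_symPow {g' : Type*} [AddCommGroup g'] [Module ℝ g']
    (φ : Module.Dual ℝ g →ₗ[ℝ] Module.Dual ℝ g') (k : ℕ)
    {x : SymmetricAlgebra ℝ (Module.Dual ℝ g)} (hx : x ∈ symPow g k) :
    SymmetricAlgebra.lift (SymmetricAlgebra.ι ℝ (Module.Dual ℝ g') ∘ₗ φ) x ∈ symPow g' k := by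
  induction k generalizing x with
  | zero =>
    rw [symPow, pow_zero, Submodule.mem_one] at hx ⊢
    obtain ⟨r, rfl⟩ := hx
    exact ⟨r, by simp⟩
  | succ k ih =>
    refine symPow_succ_induction (P := fun x => SymmetricAlgebra.lift
      (SymmetricAlgebra.ι ℝ (Module.Dual ℝ g') ∘ₗ φ) x ∈ symPow g' (k + 1)) ?_ ?_ hx
    · intro w y hy
      rw [map_mul, add_comm]
      refine mul_mem_symPow ?_ (ih hy)
      simpa using linForm_mem_symPow (φ w)
    · intro x y hx hy
      rw [map_add]
      exact Submodule.add_mem _ hx hy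

theorem restrictSym_mem_symPow (h : Submodule ℝ g) {k : ℕ}
    {x : SymmetricAlgebra ℝ (Module.Dual ℝ g)} (hx : x ∈ symPow g k) :
    restrictSym h x ∈ symPow h k :=
  lift_mem_symPow _ k hx

variable {w : Module.Dual ℝ g}

/-- Restriction to the kernel of a nonzero form has a graded section, which differs from the
identity by multiples of the form. -/
theorem exists_section (hw : w ≠ 0) :
    ∃ E : SymmetricAlgebra ℝ (Module.Dual ℝ (LinearMap.ker w)) →ₐ[ℝ]
        SymmetricAlgebra ℝ (Module.Dual ℝ g),
      (∀ k, ∀ x ∈ symPow (LinearMap.ker w) k, E x ∈ symPow g k) ∧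
      (∀ x, restrictSym (LinearMap.ker w) (E x) = x) ∧
      (∀ x ∈ symPow g 0, E (restrictSym (LinearMap.ker w) x) = x) ∧
      (∀ k, ∀ x ∈ symPow g (k + 1), ∃ y ∈ symPow g k,
        x = E (restrictSym (LinearMap.ker w) x) + linForm w * y) := by
  obtain ⟨v, hv⟩ : ∃ v, w v = 1 := by
    obtain ⟨u, hu⟩ : ∃ u, w u ≠ 0 := by
      by_contra! H
      exact hw (LinearMap.ext H)
    exact ⟨(w u)⁻¹ • u, by simp [hu]⟩
  -- The projection onto `ker w` along `v`; its transpose induces the section `E`.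
  let π : g →ₗ[ℝ] LinearMap.ker w :=
    LinearMap.codRestrict _ (LinearMap.id - w.smulRight v) (fun x => by simp [hv])
  have hπ : ∀ x, (π x : g) = x - w x • v := fun x => rfl
  let E := SymmetricAlgebra.lift (SymmetricAlgebra.ι ℝ (Module.Dual ℝ g) ∘ₗ π.dualMap)
  have hE : ∀ u, E (linForm u) = linForm (π.dualMap u) := fun u => by simp [E, linForm]
  have hmem : ∀ k, ∀ x ∈ symPow (LinearMap.ker w) k, E x ∈ symPow g k :=
    fun k x hx => lift_mem_symPow _ k hx
  have hER : ∀ u : Module.Dual ℝ g,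
      linForm u = E (restrictSym (LinearMap.ker w) (linForm u)) + linForm w * algebraMap ℝ _ (u v) := by
    intro u
    have : u = π.dualMap (restrictDual (LinearMap.ker w) u) + u v • w := by
      ext x
      simp [restrictDual, hπ, mul_comm]
    rw [restrictSym_linForm, hE]
    conv_lhs => rw [this]
    rw [linForm, map_add, map_smul, mul_comm (linForm w), ← Algebra.smul_def]
  have h0 : ∀ x ∈ symPow g 0, E (restrictSym (LinearMap.ker w) x) = x := by
    intro x hx
    rw [symPow, pow_zero, Submodule.mem_one] at hx
    obtain ⟨r, rfl⟩ := hx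
    simp
  refine ⟨E, hmem, fun x => ?_, h0, fun k => ?_⟩
  · have : (restrictSym (LinearMap.ker w)).comp E = AlgHom.id ℝ _ := by
      apply SymmetricAlgebra.algHom_ext
      ext u : 1
      have h1 : restrictDual (LinearMap.ker w) (π.dualMap u) = u := by
        ext x
        have : π x = x := Subtype.ext (by rw [hπ]; simp)
        simp [restrictDual, this]
      have := congrArg (restrictSym (LinearMap.ker w)) (hE u)
      rw [restrictSym_linForm, h1] at this
      simpa using this
    exact DFunLike.congr_fun this x
  · induction k with
    | zero =>
      intro x hx
      refine symPow_succ_induction (P := fun x => ∃ y ∈ symPow g 0,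
        x = E (restrictSym (LinearMap.ker w) x) + linForm w * y) ?_ ?_ hx
      · intro u y hy
        refine ⟨algebraMap ℝ _ (u v) * y, ?_, ?_⟩
        · rw [← Algebra.smul_def]; exact Submodule.smul_mem _ _ hy
        · rw [map_mul, map_mul, h0 y hy]
          conv_lhs => rw [hER u]
          ring
      · rintro x y ⟨a, ha, hx⟩ ⟨b, hb, hy⟩
        refine ⟨a + b, Submodule.add_mem _ ha hb, ?_⟩
        conv_lhs => rw [hx, hy]
        rw [map_add, map_add]
        ring
    | succ k ih =>
      intro x hx
      refine symPow_succ_induction (P := fun x => ∃ y ∈ symPow g (k + 1),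
        x = E (restrictSym (LinearMap.ker w) x) + linForm w * y) ?_ ?_ hx
      · intro u y hy
        obtain ⟨z, hz, hyz⟩ := ih y hy
        -- With `R` the restriction, `u = E(Ru) + w·u(v)` and `y = E(Ry) + w·z`. Expanding `u·y`
        -- gives `E(R(uy)) + w·(u(v)·y + E(Ru)·z)`.
        refine ⟨algebraMap ℝ _ (u v) * y +
          E (restrictSym (LinearMap.ker w) (linForm u)) * z, ?_, ?_⟩
        · refine Submodule.add_mem _ ?_ ?_
          · rw [← Algebra.smul_def]; exact Submodule.smul_mem _ _ hy
          · rw [add_comm]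
            exact mul_mem_symPow (hmem _ _ (restrictSym_mem_symPow _ (linForm_mem_symPow u))) hz
        · rw [map_mul, map_mul]
          have h1 := hER u
          linear_combination y * h1 + E (restrictSym (LinearMap.ker w) (linForm u)) * hyz
      · rintro x y ⟨a, ha, hx⟩ ⟨b, hb, hy⟩
        refine ⟨a + b, Submodule.add_mem _ ha hb, ?_⟩
        conv_lhs => rw [hx, hy]
        rw [map_add, map_add]
        ring

/-- A form of positive degree vanishing on the kernel of `w` is divisible by `w`. -/
theorem exists_eq_linForm_mul (hw : w ≠ 0) {k : ℕ} {x : SymmetricAlgebra ℝ (Module.Dual ℝ g)}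
    (hx : x ∈ symPow g (k + 1)) (h0 : restrictSym (LinearMap.ker w) x = 0) :
    ∃ y ∈ symPow g k, x = linForm w * y := by
  obtain ⟨E, -, -, -, hE⟩ := exists_section hw
  obtain ⟨y, hy, hxy⟩ := hE k x hx
  refine ⟨y, hy, ?_⟩
  rwa [h0, map_zero, zero_add] at hxy

theorem exists_restrictSym_eq (hw : w ≠ 0) {k : ℕ}
    {x : SymmetricAlgebra ℝ (Module.Dual ℝ (LinearMap.ker w))}
    (hx : x ∈ symPow (LinearMap.ker w) k) :
    ∃ y ∈ symPow g k, restrictSym (LinearMap.ker w) y = x := by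
  obtain ⟨E, h1, h2, -, -⟩ := exists_section hw
  exact ⟨E x, h1 k x hx, h2 x⟩

@[simp]
theorem restrictSym_ker_self (w : Module.Dual ℝ g) :
    restrictSym (LinearMap.ker w) (linForm w) = 0 := by
  rw [restrictSym_linForm, restrictDual_eq_zero_iff.mpr le_rfl, linForm, map_zero]

/-- A form vanishing on the kernels of pairwise independent linear forms is divisible by their
product. -/
theorem exists_eq_prod_mul {ι : Type*} (s : Finset ι) (w : ι → Module.Dual ℝ g)
    (hind : ∀ i ∈ s, ∀ j ∈ s, i ≠ j → LinearIndependent ℝ ![w i, w j]) (h0 : ∀ i ∈ s, w i ≠ 0)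
    {k : ℕ} {x : SymmetricAlgebra ℝ (Module.Dual ℝ g)} (hx : x ∈ symPow g (k + s.card))
    (hR : ∀ i ∈ s, restrictSym (LinearMap.ker (w i)) x = 0) :
    ∃ y ∈ symPow g k, x = (∏ i ∈ s, linForm (w i)) * y := by
  classical
  induction s using Finset.induction_on generalizing k with
  | empty => exact ⟨x, by simpa using hx, by simp⟩
  | insert a s ha ih =>
    rw [Finset.card_insert_of_notMem ha, add_comm s.card, ← add_assoc] at hx
    obtain ⟨y, hy, rfl⟩ := ih
      (fun i hi j hj => hind i (Finset.mem_insert_of_mem hi) j (Finset.mem_insert_of_mem hj))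
      (fun i hi => h0 i (Finset.mem_insert_of_mem hi)) hx
      (fun i hi => hR i (Finset.mem_insert_of_mem hi))
    have h := hR a (Finset.mem_insert_self _ _)
    rw [map_mul, map_prod, mul_eq_zero, Finset.prod_eq_zero_iff] at h
    -- The symmetric algebra of the dual of `ker (w a)` is a domain. No other factor `w i` restricts
    -- to zero there, since it would then be a multiple of `w a`.
    have hy0 : restrictSym (LinearMap.ker (w a)) y = 0 := by
      refine h.resolve_left ?_
      rintro ⟨i, hi, hi0⟩
      rw [restrictSym_linForm] at hi0
      have hle := restrictDual_eq_zero_iff.mp (linForm_injective (hi0.trans (map_zero _).symm))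
      have hspan : w i ∈ Submodule.span ℝ (Set.range fun _ : Unit => w a) := by
        apply mem_span_of_iInf_ker_le_ker
        simpa using hle
      simp only [Set.range_const, Submodule.mem_span_singleton] at hspan
      obtain ⟨c, hc⟩ := hspan
      have hia : a ≠ i := fun h => ha (h ▸ hi)
      have := hind a (Finset.mem_insert_self _ _) i (Finset.mem_insert_of_mem hi) hia
      rw [LinearIndependent.pair_iff] at this
      have := this c (-1) (by rw [hc]; simp)
      simp at this
    obtain ⟨z, hz, rfl⟩ := exists_eq_linForm_mul (h0 a (Finset.mem_insert_self _ _)) hy hy0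
    exact ⟨z, hz, by rw [Finset.prod_insert ha]; ring⟩

end SymmetricPowers

/-! ### Growth of shifted powers and of multichoose numbers -/

section Asymptotics

/-- The exponent may be negative, so `m - c` must be compared with `m` in both directions. -/
theorem isBigO_natCast_sub_zpow (c : ℕ) (z : ℤ) :
    (fun m : ℕ => ((m - c : ℕ) : ℝ) ^ z) =O[atTop] (fun m : ℕ => (m : ℝ) ^ z) := by
  have h : (fun m : ℕ => ((m - c : ℕ) : ℝ)) =Θ[atTop] (fun m : ℕ => (m : ℝ)) := by
    constructor
    · refine IsBigO.of_bound 1 (Eventually.of_forall fun m => ?_)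
      simp
    · refine IsBigO.of_bound (c + 1) ?_
      filter_upwards [eventually_ge_atTop (c + 1)] with m hm
      obtain ⟨j, rfl⟩ := Nat.exists_eq_add_of_le hm
      have : c + 1 + j - c = j + 1 := by omega
      rw [this]
      simp only [Real.norm_natCast]
      push_cast
      nlinarith [Nat.cast_nonneg (α := ℝ) j, Nat.cast_nonneg (α := ℝ) c,
        mul_nonneg (Nat.cast_nonneg (α := ℝ) j) (Nat.cast_nonneg (α := ℝ) c)]
  exact (h.zpow z).1

theorem IsBigO.natCast_zpow_comp_sub {f : ℕ → ℝ} {z : ℤ}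
    (hf : f =O[atTop] (fun m : ℕ => (m : ℝ) ^ z)) (c : ℕ) :
    (fun m => f (m - c)) =O[atTop] (fun m : ℕ => (m : ℝ) ^ z) :=
  (hf.comp_tendsto (tendsto_sub_atTop_nat c)).trans (isBigO_natCast_sub_zpow c z)

theorem isBigO_multichoose (n : ℕ) :
    (fun k : ℕ => (n.multichoose k : ℝ)) =O[atTop] (fun k : ℕ => (k : ℝ) ^ ((n : ℤ) - 1)) := by
  cases n with
  | zero =>
    refine IsBigO.of_bound 1 ?_
    filter_upwards [eventually_ge_atTop 1] with k hk
    obtain ⟨j, rfl⟩ := Nat.exists_eq_add_of_le' hk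
    simp only [Nat.multichoose_zero_succ, Nat.cast_zero, norm_zero]
    positivity
  | succ n =>
    refine IsBigO.of_bound ((n + 1 : ℝ) ^ n) ?_
    filter_upwards [eventually_ge_atTop 1] with k hk
    have h1 : (n + 1).multichoose k ≤ (n + k) ^ n := by
      rw [Nat.multichoose_eq]
      have h2 : n + 1 + k - 1 = n + k := by omega
      rw [h2, ← Nat.choose_symm_add]
      exact Nat.choose_le_pow _ _
    have h3 : n + k ≤ (n + 1) * k := by nlinarith
    have h4 := h1.trans (Nat.pow_le_pow_left h3 n)
    have h5 : ((n + 1 : ℕ) : ℤ) - 1 = n := by push_cast; ring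
    rw [h5, zpow_natCast, Real.norm_natCast, norm_pow, Real.norm_natCast, ← mul_pow]
    exact_mod_cast h4

end Asymptotics

/-! ### Codimension of graded subspaces containing products of linear forms -/

section Dimension

theorem finrank_map_add_finrank_inf_ker {M N : Type*} [AddCommGroup M] [Module ℝ M]
    [AddCommGroup N] [Module ℝ N] (f : M →ₗ[ℝ] N) (W : Submodule ℝ M) [FiniteDimensional ℝ W] :
    Module.finrank ℝ (W.map f) + Module.finrank ℝ (W ⊓ LinearMap.ker f : Submodule ℝ M) =
      Module.finrank ℝ W := by
  rw [← LinearMap.finrank_range_add_finrank_ker (f.domRestrict W), LinearMap.range_domRestrict]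
  congr 1
  rw [LinearMap.ker_domRestrict, ← Submodule.finrank_map_subtype_eq, Submodule.map_comap_subtype]

variable {g : Type*} [AddCommGroup g] [Module ℝ g] {w : Module.Dual ℝ g}

theorem map_restrictSym_symPow (hw : w ≠ 0) (k : ℕ) :
    (symPow g k).map (restrictSym (LinearMap.ker w)).toLinearMap =
      symPow (LinearMap.ker w) k := by
  apply le_antisymm
  · rintro _ ⟨x, hx, rfl⟩
    exact restrictSym_mem_symPow _ hx
  · intro x hx
    obtain ⟨y, hy, rfl⟩ := exists_restrictSym_eq hw hx
    exact ⟨y, hy, rfl⟩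

/-- The quotients of degree `k` by the form `w` of the elements of a subspace. -/
def quotientBy (w : Module.Dual ℝ g) (k : ℕ)
    (W : Submodule ℝ (SymmetricAlgebra ℝ (Module.Dual ℝ g))) :
    Submodule ℝ (SymmetricAlgebra ℝ (Module.Dual ℝ g)) :=
  symPow g k ⊓ W.comap (LinearMap.mulLeft ℝ (linForm w))

theorem quotientBy_symPow (w : Module.Dual ℝ g) (k : ℕ) :
    quotientBy w k (symPow g (k + 1)) = symPow g k := by
  refine le_antisymm inf_le_left fun x hx => ⟨hx, ?_⟩
  have := mul_mem_symPow (linForm_mem_symPow w) hx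
  rwa [add_comm] at this

/-- A combination that vanishes on `ker (w a)` is a multiple of `w a`. Passing to this hyperplane
thus costs one degree of independence. -/
theorem linearIndepOn_restrictDual {ι : Type*} [DecidableEq ι] {w : ι → Module.Dual ℝ g}
    {a : ι} {t : Finset ι}
    (ha : a ∉ t) (h : LinearIndepOn ℝ w (insert a t : Finset ι)) :
    LinearIndepOn ℝ (fun i => restrictDual (LinearMap.ker (w a)) (w i)) (t : Set ι) := by
  rw [linearIndepOn_finset_iff] at h ⊢
  intro c hc i hi
  have hle : LinearMap.ker (w a) ≤ LinearMap.ker (∑ i ∈ t, c i • w i) := by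
    rw [← restrictDual_eq_zero_iff, map_sum]
    simpa using hc
  have hspan : (∑ i ∈ t, c i • w i) ∈ Submodule.span ℝ (Set.range fun _ : Unit => w a) := by
    apply mem_span_of_iInf_ker_le_ker
    simpa using hle
  simp only [Set.range_const, Submodule.mem_span_singleton] at hspan
  obtain ⟨b, hb⟩ := hspan
  have hne : ∀ j ∈ t, j ≠ a := fun j hj h => ha (h ▸ hj)
  have := h (fun j => if j = a then -b else c j) (by
    rw [Finset.sum_insert ha, if_pos rfl, Finset.sum_congr rfl
      (g := fun j => c j • w j) (fun j hj => by rw [if_neg (hne j hj)]), ← hb]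
    simp) i (Finset.mem_insert_of_mem hi)
  simpa [hne i hi] using this

variable [FiniteDimensional ℝ g]

instance finiteDimensional_symPow (k : ℕ) : FiniteDimensional ℝ (symPow g k) := by
  rw [FiniteDimensional, Module.Finite.iff_fg]
  refine Submodule.FG.pow ?_ k
  rw [← Module.Finite.iff_fg]
  infer_instance

theorem finiteDimensional_of_le_symPow {k : ℕ}
    {W : Submodule ℝ (SymmetricAlgebra ℝ (Module.Dual ℝ g))} (hW : W ≤ symPow g k) :
    FiniteDimensional ℝ W :=
  Submodule.finiteDimensional_of_le hW

/-- Rank-nullity for restriction to `ker w`: by divisibility its kernel on `W` consists of multiples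
of `w`, and multiplication by `w` is injective. -/
theorem finrank_eq_restrict_add_quotientBy (hw : w ≠ 0) {k : ℕ}
    {W : Submodule ℝ (SymmetricAlgebra ℝ (Module.Dual ℝ g))} (hW : W ≤ symPow g (k + 1)) :
    Module.finrank ℝ (W.map (restrictSym (LinearMap.ker w)).toLinearMap) +
      Module.finrank ℝ (quotientBy w k W) = Module.finrank ℝ W := by
  have := finiteDimensional_of_le_symPow hW
  rw [← finrank_map_add_finrank_inf_ker (restrictSym (LinearMap.ker w)).toLinearMap W]
  congr 1
  have hinj : Function.Injective (LinearMap.mulLeft ℝ (linForm w)) := fun x y hxy =>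
    mul_left_cancel₀ (linForm_ne_zero hw) hxy
  rw [LinearEquiv.finrank_eq (Submodule.equivMapOfInjective _ hinj (quotientBy w k W))]
  suffices h : (quotientBy w k W).map (LinearMap.mulLeft ℝ (linForm w)) =
      W ⊓ LinearMap.ker (restrictSym (LinearMap.ker w)).toLinearMap by rw [h]
  ext x
  constructor
  · rintro ⟨y, hy, rfl⟩
    refine ⟨hy.2, ?_⟩
    change restrictSym (LinearMap.ker w) (linForm w * y) = 0
    rw [map_mul, restrictSym_ker_self, zero_mul]
  · rintro ⟨hx, hx0⟩
    obtain ⟨y, hy, rfl⟩ := exists_eq_linForm_mul hw (hW hx) hx0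
    exact ⟨y, ⟨hy, hx⟩, rfl⟩

theorem finrank_ker_add_one (hw : w ≠ 0) :
    Module.finrank ℝ (LinearMap.ker w) + 1 = Module.finrank ℝ g :=
  Module.Dual.finrank_ker_add_one_of_ne_zero hw

/-- Restriction to a hyperplane and division by its form reproduce the Pascal recursion of
`multichoose`. Only an upper bound is needed. -/
theorem finrank_symPow_le_multichoose (k : ℕ) :
    Module.finrank ℝ (symPow g k) ≤ (Module.finrank ℝ g).multichoose k := by
  have main : ∀ (n : ℕ) (g : Type _) [AddCommGroup g] [Module ℝ g] [FiniteDimensional ℝ g],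
      Module.finrank ℝ g = n → ∀ k, Module.finrank ℝ (symPow g k) ≤ n.multichoose k := by
    intro n
    induction n with
    | zero =>
      intro g _ _ _ hg k
      cases k with
      | zero =>
        rw [symPow, pow_zero, Submodule.one_eq_span, Nat.multichoose_zero_right]
        exact finrank_span_le_card {_} |>.trans (by simp)
      | succ k =>
        have hd : Subsingleton (Module.Dual ℝ g) := by
          rw [← Module.finrank_zero_iff (R := ℝ), Subspace.dual_finrank_eq, hg]
        have : LinearMap.range (SymmetricAlgebra.ι ℝ (Module.Dual ℝ g)) = ⊥ := by
          rw [LinearMap.range_eq_bot]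
          ext x
          rw [Subsingleton.elim x 0, map_zero, map_zero]
        rw [symPow, pow_succ, this, Submodule.mul_bot, finrank_bot]
        exact Nat.zero_le _
    | succ n ih =>
      intro g _ _ _ hg k
      induction k with
      | zero =>
        rw [symPow, pow_zero, Submodule.one_eq_span, Nat.multichoose_zero_right]
        exact finrank_span_le_card {_} |>.trans (by simp)
      | succ k ihk =>
        have : Nontrivial (Module.Dual ℝ g) := by
          rw [← Module.finrank_pos_iff (R := ℝ), Subspace.dual_finrank_eq, hg]
          omega
        obtain ⟨w, hw⟩ := exists_ne (0 : Module.Dual ℝ g)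
        rw [← finrank_eq_restrict_add_quotientBy hw le_rfl, quotientBy_symPow,
          map_restrictSym_symPow hw, Nat.multichoose_succ_succ]
        refine add_le_add (ih _ ?_ _) ihk
        have := finrank_ker_add_one hw
        omega
  exact main _ g rfl k

theorem isBigO_finrank_symPow :
    (fun k : ℕ => (Module.finrank ℝ (symPow g k) : ℝ)) =O[atTop]
      (fun k : ℕ => (k : ℝ) ^ ((Module.finrank ℝ g : ℤ) - 1)) := by
  refine IsBigO.trans (IsBigO.of_bound 1 (Eventually.of_forall fun k => ?_))
    (isBigO_multichoose (Module.finrank ℝ g))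
  rw [Real.norm_natCast, Real.norm_natCast, one_mul]
  exact_mod_cast finrank_symPow_le_multichoose k

/-- If the graded subspace `W` contains the multiples of the products of all but fewer than `l`
members of an `l`-independent family, then the codimension of `W` in degree `m` grows as the
dimension of the polynomials on a space of codimension `l`. -/
theorem isBigO_codim_of_prod_mem {ι : Type*} [DecidableEq ι] (s : Finset ι)
    (w : ι → Module.Dual ℝ g) (l : ℕ)
    (hw : ∀ t ⊆ s, t.card ≤ l → LinearIndepOn ℝ w (t : Set ι))
    (W : ℕ → Submodule ℝ (SymmetricAlgebra ℝ (Module.Dual ℝ g)))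
    (hW : ∀ m, W m ≤ symPow g m)
    (hmul : ∀ B ⊆ s, B.card < l → ∀ j, ∀ y ∈ symPow g j,
      (∏ i ∈ s \ B, linForm (w i)) * y ∈ W (j + (s \ B).card)) :
    (fun m : ℕ => (Module.finrank ℝ (symPow g m) : ℝ) - Module.finrank ℝ (W m)) =O[atTop]
      (fun m : ℕ => (m : ℝ) ^ ((Module.finrank ℝ g : ℤ) - 1 - l)) := by
  -- The space must vary, because the induction passes to a hyperplane.
  revert g
  induction s using Finset.induction_on generalizing l with
  | empty =>
    intro g _ _ _ w hw W hW hmul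
    rcases Nat.eq_zero_or_pos l with rfl | hl
    · refine IsBigO.trans (IsBigO.of_bound 1 (Eventually.of_forall fun m => ?_))
        (by simpa using isBigO_finrank_symPow (g := g))
      have := Submodule.finrank_mono (hW m)
      have h' : (Module.finrank ℝ (W m) : ℝ) ≤ Module.finrank ℝ (symPow g m) := by exact_mod_cast this
      rw [Real.norm_of_nonneg (by linarith), Real.norm_natCast, one_mul]
      linarith [Nat.cast_nonneg (α := ℝ) (Module.finrank ℝ (W m))]
    · have : ∀ m, W m = symPow g m := fun m => le_antisymm (hW m) fun y hy => by
        simpa using hmul ∅ (Finset.Subset.refl _) (by simpa using hl) m y hy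
      exact (isBigO_zero _ _).congr_left fun m => by rw [this m, sub_self]
  | insert a s ha ih =>
    intro g _ _ _ w hw W hW hmul
    rcases l with _ | l
    · refine IsBigO.trans (IsBigO.of_bound 1 (Eventually.of_forall fun m => ?_))
        (by simpa using isBigO_finrank_symPow (g := g))
      have := Submodule.finrank_mono (hW m)
      have h' : (Module.finrank ℝ (W m) : ℝ) ≤ Module.finrank ℝ (symPow g m) := by exact_mod_cast this
      rw [Real.norm_of_nonneg (by linarith), Real.norm_natCast, one_mul]
      linarith [Nat.cast_nonneg (α := ℝ) (Module.finrank ℝ (W m))]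
    · have hwa : w a ≠ 0 := by
        have := hw {a} (by simp) (by simp)
        simpa using this
      -- Division by `w a` keeps the space and the level of independence: for `B ⊆ s` the factor `w
      -- a` occurs in the product and is removed.
      have h1 := ih (l + 1) w (fun t ht => hw t (ht.trans (Finset.subset_insert _ _)))
        (fun m => quotientBy (w a) m (W (m + 1))) (fun m => inf_le_left) (by
          intro B hB hBl j y hy
          have haB : a ∉ s \ B := fun h => ha (Finset.mem_sdiff.mp h).1
          have hs : insert a s \ B = insert a (s \ B) :=
            Finset.insert_sdiff_of_notMem _ fun h => ha (hB h)
          refine ⟨?_, ?_⟩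
          · rw [add_comm]
            exact mul_mem_symPow (prod_linForm_mem_symPow _ _) hy
          · have := hmul B (hB.trans (Finset.subset_insert _ _)) hBl j y hy
            rw [hs, Finset.prod_insert haB, Finset.card_insert_of_notMem haB, mul_assoc] at this
            exact this)
      -- On the hyperplane both the dimension and, in this case, `l + 1` drop by one. Adding `a` to
      -- `B` removes the factor `w a`, which would restrict to zero.
      have h2 := ih l (g := LinearMap.ker (w a)) (fun i => restrictDual (LinearMap.ker (w a)) (w i))
        (fun t ht htl => linearIndepOn_restrictDual (fun h => ha (ht h))
          (hw _ (Finset.insert_subset_insert _ ht)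
            ((Finset.card_insert_le _ _).trans (by omega))))
        (fun m => (W m).map (restrictSym (LinearMap.ker (w a))).toLinearMap)
        (fun m => (Submodule.map_mono (hW m)).trans (map_restrictSym_symPow hwa m).le) (by
          intro B hB hBl j y hy
          obtain ⟨z, hz, rfl⟩ := exists_restrictSym_eq hwa hy
          have hs : insert a s \ insert a B = s \ B := by
            ext i
            simp only [Finset.mem_sdiff, Finset.mem_insert, not_or]
            constructor
            · rintro ⟨h1 | h1, h2, h3⟩
              · exact absurd h1 h2
              · exact ⟨h1, h3⟩
            · rintro ⟨h1, h2⟩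
              exact ⟨Or.inr h1, fun h => ha (h ▸ h1), h2⟩
          have := hmul (insert a B) (Finset.insert_subset_insert _ hB)
            (lt_of_le_of_lt (Finset.card_insert_le _ _) (by omega)) j z hz
          rw [hs] at this
          refine ⟨_, this, ?_⟩
          simp [map_prod])
      have hd := finrank_ker_add_one hwa
      have hz : (Module.finrank ℝ (LinearMap.ker (w a)) : ℤ) - 1 - l =
          (Module.finrank ℝ g : ℤ) - 1 - ((l + 1 : ℕ) : ℤ) := by
        rw [← hd]; push_cast; ring
      rw [hz] at h2
      -- The codimension in degree `m` is that of the restriction in degree `m` plus that of the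
      -- quotient in degree `m - 1`.
      refine ((IsBigO.natCast_zpow_comp_sub h1 1).add h2).congr' ?_ EventuallyEq.rfl
      filter_upwards [eventually_ge_atTop 1] with m hm
      obtain ⟨k, rfl⟩ := Nat.exists_eq_add_of_le' hm
      have e1 := finrank_eq_restrict_add_quotientBy hwa (hW (k + 1))
      have e2 := finrank_eq_restrict_add_quotientBy hwa (le_refl (symPow g (k + 1)))
      rw [quotientBy_symPow, map_restrictSym_symPow hwa] at e2
      rw [← e1, ← e2, Nat.add_sub_cancel]
      push_cast
      ring

end Dimension

/-! ### Wall crossing and invariance of the Betti numbers -/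

section BettiInvariance

variable {V : Type*} {g : Type*} [AddCommGroup g] [Module ℝ g]
  {G : SimpleGraph V} {α : G.Dart → Module.Dual ℝ g}

instance finite_dart [Finite V] : Finite G.Dart :=
  Finite.of_injective _ SimpleGraph.Dart.toProd_injective

/-- `η` is generic and no form `α d` that does not vanish at `ξ₀` changes its sign from `ξ₀` to
`η`. -/
def IsNear (α : G.Dart → Module.Dual ℝ g) (ξ₀ η : g) : Prop :=
  η ∈ generic G α ∧ ∀ d, α d ξ₀ ≠ 0 → 0 < α d ξ₀ * α d η

theorem IsNear.neg_iff {ξ₀ η : g} (h : IsNear α ξ₀ η) {d : G.Dart} (hd : α d ξ₀ ≠ 0) :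
    α d η < 0 ↔ α d ξ₀ < 0 := by
  have := h.2 d hd
  constructor <;> intro h' <;> by_contra! h'' <;> nlinarith

variable [Finite V]

theorem index_eq_add {ξ₀ η : g} (h : IsNear α ξ₀ η) (p : V) :
    index G α η p = index G α ξ₀ p +
      Nat.card {x : OutEdges G p // α x.1 ξ₀ = 0 ∧ α x.1 η < 0} := by
  classical
  have := Fintype.ofFinite (OutEdges G p)
  rw [index, index, Nat.card_eq_fintype_card, Nat.card_eq_fintype_card, Nat.card_eq_fintype_card,
    Fintype.card_subtype, Fintype.card_subtype, Fintype.card_subtype,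
    ← Finset.card_union_of_disjoint]
  · congr 1
    ext x
    simp only [Finset.mem_filter, Finset.mem_univ, true_and, Finset.mem_union]
    by_cases hx : α x.1 ξ₀ = 0
    · simp [hx]
    · simp [hx, h.neg_iff hx]
  · rw [Finset.disjoint_filter]
    rintro x - hx ⟨h0, -⟩
    exact hx.ne h0

-- Since `ξ₀` lies in the kernel of `α d`, the matching along `d` preserves values at `ξ₀`.
omit [Finite V] in
theorem index_fst_eq_index_snd (hα : IsAxialFunction G α) {ξ₀ : g} {d : G.Dart}
    (hd : α d ξ₀ = 0) : index G α ξ₀ d.fst = index G α ξ₀ d.snd := by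
  obtain ⟨θ, -, hθ⟩ := hα.compatible d
  refine Nat.card_congr (θ.subtypeEquiv fun x => ?_)
  have : α x.1 ξ₀ = α (θ x).1 ξ₀ := LinearMap.congr_fun (hθ x) ⟨ξ₀, hd⟩
  rw [this]

omit [Finite V] in
theorem card_zero_neg {ξ₀ η : g}
    (hsep : ∀ d d' : G.Dart, d.fst = d'.fst → α d ξ₀ = 0 → α d' ξ₀ = 0 → d = d')
    {d : G.Dart} (hd : α d ξ₀ = 0) [Decidable (α d η < 0)] :
    Nat.card {x : OutEdges G d.fst // α x.1 ξ₀ = 0 ∧ α x.1 η < 0} =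
      if α d η < 0 then 1 else 0 := by
  have key : ∀ x : OutEdges G d.fst, α x.1 ξ₀ = 0 → x = ⟨d, rfl⟩ := fun x hx =>
    Subtype.ext (hsep _ _ x.2 hx hd)
  split_ifs with h
  · rw [Nat.card_eq_one_iff_unique]
    refine ⟨⟨fun x y => Subtype.ext ((key _ x.2.1).trans (key _ y.2.1).symm)⟩,
      ⟨⟨⟨d, rfl⟩, hd, h⟩⟩⟩
  · have : IsEmpty {x : OutEdges G d.fst // α x.1 ξ₀ = 0 ∧ α x.1 η < 0} := ⟨fun x => h (by
      have := x.2.2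
      rwa [key _ x.2.1] at this)⟩
    exact Nat.card_of_isEmpty

/-- Crossing a wall that contains at most one direction at each vertex permutes the indices. -/
theorem betti_eq_of_isNear (hα : IsAxialFunction G α) {ξ₀ η₁ η₂ : g}
    (hsep : ∀ d d' : G.Dart, d.fst = d'.fst → α d ξ₀ = 0 → α d' ξ₀ = 0 → d = d')
    (h₁ : IsNear α ξ₀ η₁) (h₂ : IsNear α ξ₀ η₂) (r : ℕ) :
    betti G α η₁ r = betti G α η₂ r := by
  classical
  -- `Q p d` says that `d` issues from `p` and changes sign at the wall; `σ` exchanges the ends of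
  -- such edges. As `α d.symm = -α d`, the edge is descending at `p` for `η₁` exactly when it is
  -- descending at `σ p` for `η₂`.
  let Q : V → G.Dart → Prop := fun p d => d.fst = p ∧ α d ξ₀ = 0 ∧ α d η₁ * α d η₂ < 0
  let σ : V → V := fun p => if h : ∃ d, Q p d then h.choose.snd else p
  have hσ : ∀ p d, Q p d → σ p = d.snd := by
    intro p d hd
    have h : ∃ d, Q p d := ⟨d, hd⟩
    have : h.choose = d := hsep _ _ (h.choose_spec.1.trans hd.1.symm) h.choose_spec.2.1 hd.2.1
    simp only [σ, dif_pos h, this]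
  have hσ' : ∀ p, (¬ ∃ d, Q p d) → σ p = p := fun p hp => dif_neg hp
  have hQ : ∀ p d, Q p d → Q d.snd d.symm := by
    rintro p d ⟨-, h0, hneg⟩
    refine ⟨rfl, by rw [hα.symm]; simp [h0], ?_⟩
    rw [hα.symm]
    simpa using hneg
  have hinv : Function.Involutive σ := by
    intro p
    by_cases h : ∃ d, Q p d
    · obtain ⟨d, hd⟩ := h
      rw [hσ p d hd, hσ _ _ (hQ p d hd)]
      exact hd.1
    · rw [hσ' p h, hσ' p h]
  refine Nat.card_congr (hinv.toPerm.subtypeEquiv fun p => ?_)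
  suffices h : index G α η₁ p = index G α η₂ (σ p) by
    rw [h]; rfl
  rw [index_eq_add h₁, index_eq_add h₂]
  by_cases h : ∃ d, Q p d
  · obtain ⟨d, hd⟩ := h
    rw [hσ p d hd]
    obtain ⟨rfl, h0, hneg⟩ := hd
    have h0' : α d.symm ξ₀ = 0 := by rw [hα.symm]; simp [h0]
    have e2 := card_zero_neg (η := η₂) hsep h0'
    rw [index_fst_eq_index_snd hα h0, card_zero_neg hsep h0]
    change _ = _ + Nat.card {x : OutEdges G d.symm.fst // α x.1 ξ₀ = 0 ∧ α x.1 η₂ < 0}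
    rw [e2, hα.symm]
    congr 1
    simp only [LinearMap.neg_apply, Left.neg_neg_iff]
    rcases mul_neg_iff.mp hneg with ⟨a, b⟩ | ⟨a, b⟩
    · rw [if_neg (by linarith), if_neg (by linarith)]
    · rw [if_pos a, if_pos b]
  · rw [hσ' p h]
    congr 1
    refine Nat.card_congr (Equiv.subtypeEquivRight fun x => and_congr_right fun hx => ?_)
    have hn : ¬ α x.1 η₁ * α x.1 η₂ < 0 := fun hn => h ⟨x.1, x.2, hx, hn⟩
    have a := h₁.1 x.1
    have b := h₂.1 x.1
    rw [mul_neg_iff] at hn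
    push Not at hn
    constructor
    · intro h'
      exact lt_of_le_of_ne (hn.2 h') b
    · intro h'
      by_contra! h''
      exact absurd (hn.1 (lt_of_le_of_ne h'' a.symm)) (not_le.mpr h')

/-- The inequality prevents two weights at a vertex from vanishing at the same point of the line
through `ξ` and `ζ`. By pairwise independence it excludes only finitely many hyperplanes, which a
small perturbation of `ξ'` avoids. -/
theorem exists_near_forall_ne (hα : IsAxialFunction G α) {ξ ξ' : g} (hξ : ξ ∈ generic G α)
    (hξ' : ξ' ∈ generic G α) :
    ∃ ζ : g, (∀ d, 0 < α d ξ' * α d ζ) ∧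
      ∀ d d' : G.Dart, d.fst = d'.fst → d ≠ d' → α d ξ * α d' ζ ≠ α d' ξ * α d ζ := by
  let I := {x : G.Dart × G.Dart // x.1.fst = x.2.fst ∧ x.1 ≠ x.2}
  let L : I → Module.Dual ℝ g := fun x => α x.1.1 ξ • α x.1.2 - α x.1.2 ξ • α x.1.1
  have hL : ∀ x, ∃ v, L x v ≠ 0 := by
    intro x
    by_contra! H
    have h := hα.pairwise_independent _ _ x.2.1 x.2.2
    rw [LinearIndependent.pair_iff] at h
    have := h (-(α x.1.2 ξ)) (α x.1.1 ξ) (by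
      rw [neg_smul, neg_add_eq_sub]
      exact LinearMap.ext H)
    exact hξ _ this.2
  obtain ⟨η, hη⟩ := Module.Dual.exists_forall_ne_zero_of_forall_exists L hL
  have hc : ∀ f : Module.Dual ℝ g, Continuous fun ε : ℝ => f (ξ' + ε • η) := fun f => by
    simp only [map_add, map_smul, smul_eq_mul]
    fun_prop
  have e1 : ∀ᶠ ε : ℝ in nhdsWithin 0 (Set.Ioi 0), ∀ d, 0 < α d ξ' * α d (ξ' + ε • η) := by
    rw [eventually_all]
    intro d
    have : ContinuousAt (fun ε : ℝ => α d ξ' * α d (ξ' + ε • η)) 0 :=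
      (continuous_const.mul (hc _)).continuousAt
    refine nhdsWithin_le_nhds (this.eventually (lt_mem_nhds ?_))
    simpa using mul_self_pos.mpr (hξ' d)
  have e2 : ∀ᶠ ε : ℝ in nhdsWithin 0 (Set.Ioi 0), ∀ x, L x (ξ' + ε • η) ≠ 0 := by
    rw [eventually_all]
    intro x
    by_cases h0 : L x ξ' = 0
    · filter_upwards [self_mem_nhdsWithin] with ε hε
      rw [map_add, h0, zero_add, map_smul]
      exact mul_ne_zero (ne_of_gt hε) (hη x)
    · refine nhdsWithin_le_nhds ((hc (L x)).continuousAt.eventually (isOpen_ne.mem_nhds ?_))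
      simpa using h0
  obtain ⟨ε, h1, h2⟩ := (e1.and e2).exists
  refine ⟨ξ' + ε • η, h1, fun d d' hd hne h => h2 ⟨(d, d'), hd, hne⟩ ?_⟩
  simp only [L, LinearMap.sub_apply, LinearMap.smul_apply, smul_eq_mul]
  linarith

/-- A weight is nonzero at `ξ`, so if it vanishes at `t` it is not constant along the line and `t`
is an isolated zero. -/
theorem eventually_isNear {ξ v : g} (hξ : ξ ∈ generic G α) (t : ℝ) :
    ∀ᶠ s in nhdsWithin t {t}ᶜ, IsNear α (ξ + t • v) (ξ + s • v) := by
  simp only [IsNear, generic, Set.mem_ofPred_eq, ← forall_and, eventually_all]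
  intro d
  have hc : Continuous fun s : ℝ => α d (ξ + s • v) := by
    simp only [map_add, map_smul, smul_eq_mul]
    fun_prop
  by_cases h0 : α d (ξ + t • v) = 0
  · filter_upwards [self_mem_nhdsWithin] with s hs
    refine ⟨fun h => ?_, fun h => absurd h0 h⟩
    simp only [map_add, map_smul, smul_eq_mul] at h h0
    have : (s - t) * α d v = 0 := by linarith
    rcases mul_eq_zero.mp this with h1 | h1
    · exact hs (sub_eq_zero.mp h1)
    · rw [h1] at h0
      exact hξ d (by linarith)
  · have : ∀ᶠ s in nhds t, 0 < α d (ξ + t • v) * α d (ξ + s • v) :=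
      (continuous_const.mul hc).continuousAt.eventually (lt_mem_nhds (mul_self_pos.mpr h0))
    filter_upwards [nhdsWithin_le_nhds this] with s hs
    exact ⟨(right_ne_zero_of_mul hs.ne'), fun _ => hs⟩

/-- The Betti numbers do not depend on the generic vector used to compute them. -/
theorem betti_eq_of_generic (hα : IsAxialFunction G α) {ξ ξ' : g} (hξ : ξ ∈ generic G α)
    (hξ' : ξ' ∈ generic G α) (r : ℕ) : betti G α ξ r = betti G α ξ' r := by
  obtain ⟨ζ, hζ, hsepζ⟩ := exists_near_forall_ne hα hξ hξ'
  let c : ℝ → g := fun t => ξ + t • (ζ - ξ)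
  have hsep : ∀ t, ∀ d d' : G.Dart, d.fst = d'.fst → α d (c t) = 0 → α d' (c t) = 0 → d = d' := by
    intro t d d' hdd h h'
    by_contra hne
    apply hsepζ d d' hdd hne
    simp only [c, map_add, map_smul, map_sub, smul_eq_mul] at h h'
    have ht : t ≠ 0 := by
      rintro rfl
      exact hξ d (by simpa using h)
    have : t * (α d ξ * α d' ζ) = t * (α d' ξ * α d ζ) := by
      linear_combination α d ξ * h' - α d' ξ * h
    exact mul_left_cancel₀ ht this
  -- Comparing all generic vectors near `c s` and `c t` gives a relation that makes sense on the
  -- walls too. It holds locally, hence everywhere by connectedness of the line.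
  let P : ℝ → ℝ → Prop := fun s t =>
    ∀ η η', IsNear α (c s) η → IsNear α (c t) η' → betti G α η r = betti G α η' r
  have hP : P 0 1 := by
    refine isPreconnected_univ.induction₂ (s := Set.univ) P ?_ ?_ ?_ (Set.mem_univ 0)
      (Set.mem_univ 1)
    · intro t _
      rw [nhdsWithin_univ]
      have hev : ∀ᶠ s in nhds t, ∀ d, α d (c t) ≠ 0 → 0 < α d (c t) * α d (c s) := by
        rw [eventually_all]
        intro d
        by_cases h0 : α d (c t) = 0
        · simp [h0]
        · have hc : Continuous fun s : ℝ => α d (c t) * α d (c s) := by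
            simp only [c, map_add, map_smul, smul_eq_mul]
            fun_prop
          filter_upwards [hc.continuousAt.eventually (lt_mem_nhds (mul_self_pos.mpr h0))]
            with s hs _
          exact hs
      filter_upwards [hev] with s hs η η' hη hη'
      -- For `s` close to `t`, a vector near `c s` is also near `c t`.
      refine betti_eq_of_isNear hα (hsep t) hη ⟨hη'.1, fun d hd => ?_⟩ r
      have h1 := hs d hd
      have h2 := hη'.2 d (right_ne_zero_of_mul h1.ne')
      have h3 := mul_pos h1 h2
      have h4 : 0 < (α d (c t) * α d η') * (α d (c s) * α d (c s)) := by linarith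
      exact pos_of_mul_pos_left h4 (mul_self_nonneg _)
    · intro x y z _ _ _ hxy hyz η η' hη hη'
      obtain ⟨s, hs⟩ := (eventually_isNear (v := ζ - ξ) hξ y).exists
      exact (hxy η _ hη hs).trans (hyz _ η' hs hη')
    · intro x y _ _ h η η' hη hη'
      exact (h η' η hη' hη).symm
  refine hP ξ ξ' ⟨hξ, fun d _ => ?_⟩ ⟨hξ', fun d _ => ?_⟩
  · simpa [c] using mul_self_pos.mpr (hξ d)
  · simpa [c, mul_comm] using hζ d

end BettiInvariance

/-! ### Components of `Γ_h` as graphs with axial functions -/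

section Components

variable {V : Type*} {g : Type*} [AddCommGroup g] [Module ℝ g]
  {G : SimpleGraph V} {α : G.Dart → Module.Dual ℝ g}

theorem subgraphOf_adj (hα : IsAxialFunction G α) {h : Submodule ℝ g} {d : G.Dart}
    (hd : restrictDual h (α d) = 0) : (subgraphOf G α h).Adj d.fst d.snd := by
  refine ⟨d.adj, hd, ?_⟩
  have : restrictDual h (α d.symm) = 0 := by rw [hα.symm, map_neg, hd, neg_zero]
  exact this

/-- If `h` lies in the kernel of `α d`, the matching along `d` preserves the edges of `Γ_h`. -/
theorem restrictDual_eq_zero_iff_of_compatible {h : Submodule ℝ g} {u v w : Module.Dual ℝ g}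
    (hw : restrictDual h w = 0)
    (huv : restrictDual (LinearMap.ker w) u = restrictDual (LinearMap.ker w) v) :
    restrictDual h u = 0 ↔ restrictDual h v = 0 := by
  have hle := restrictDual_eq_zero_iff.mp hw
  have : restrictDual h u = restrictDual h v := by
    ext ⟨x, hx⟩
    exact LinearMap.congr_fun huv ⟨x, hle hx⟩
  rw [this]

theorem componentAxial_apply_eq_zero {h : Submodule ℝ g}
    (C : (subgraphOf G α h).ConnectedComponent) (d : C.toSimpleGraph.Dart) :
    restrictDual h (componentAxial G α h C d) = 0 := by
  have hadj : (subgraphOf G α h).Adj d.fst.1 d.snd.1 := C.toSimpleGraph_hom.map_adj d.adj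
  exact hadj.2.1

/-- The edges of a component of `Γ_h` at a vertex are the edges of the whole graph on which `α`
restricts to zero on `h`. -/
def componentOutEdgesEquiv (hα : IsAxialFunction G α) {h : Submodule ℝ g}
    (C : (subgraphOf G α h).ConnectedComponent) (p : C) :
    OutEdges C.toSimpleGraph p ≃ {x : OutEdges G p.1 // restrictDual h (α x.1) = 0} :=
  Equiv.ofBijective
    (fun x => ⟨⟨(componentHom G α h C).mapDart x.1, congrArg Subtype.val x.2⟩,
      componentAxial_apply_eq_zero C x.1⟩) (by
    constructor
    · intro x y hxy
      have h1 : (componentHom G α h C).mapDart x.1 = (componentHom G α h C).mapDart y.1 :=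
        congrArg (fun z => z.1.1) hxy
      apply Subtype.ext
      apply SimpleGraph.Dart.ext
      apply Prod.ext
      · exact x.2.trans y.2.symm
      · exact Subtype.ext (congrArg (fun z => z.snd) h1)
    · rintro ⟨⟨d, hd⟩, h0⟩
      have hadj := subgraphOf_adj hα h0
      obtain ⟨p, hp⟩ := p
      dsimp only at hd
      subst hd
      have hq : d.snd ∈ C.supp := (C.mem_supp_congr_adj hadj).mp hp
      refine ⟨⟨⟨(⟨d.fst, hp⟩, ⟨d.snd, hq⟩), hadj⟩, rfl⟩, ?_⟩
      rfl)

/-- The restriction of an axial function to a component of `Γ_h` is an axial function. -/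
theorem isAxialFunction_componentAxial (hα : IsAxialFunction G α) {h : Submodule ℝ g}
    (C : (subgraphOf G α h).ConnectedComponent) :
    IsAxialFunction C.toSimpleGraph (componentAxial G α h C) where
  ne_zero d := hα.ne_zero _
  symm d := hα.symm ((componentHom G α h C).mapDart d)
  pairwise_independent d d' hd hne := by
    refine hα.pairwise_independent _ _ (congrArg Subtype.val hd) fun heq => hne ?_
    apply SimpleGraph.Dart.ext
    apply Prod.ext
    · exact hd
    · exact Subtype.ext (congrArg (fun z => z.snd) heq)
  compatible d := by
    obtain ⟨θ, h1, h2⟩ := hα.compatible ((componentHom G α h C).mapDart d)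
    have h0 := componentAxial_apply_eq_zero C d
    let e₁ := componentOutEdgesEquiv hα C d.fst
    let e₂ := componentOutEdgesEquiv hα C d.snd
    let θ' : {x : OutEdges G d.fst.1 // restrictDual h (α x.1) = 0} ≃
        {x : OutEdges G d.snd.1 // restrictDual h (α x.1) = 0} :=
      θ.subtypeEquiv fun x => restrictDual_eq_zero_iff_of_compatible h0 (h2 x)
    refine ⟨(e₁.trans θ').trans e₂.symm, ?_, fun x => ?_⟩
    · rw [Equiv.trans_apply, Equiv.symm_apply_eq]
      exact Subtype.ext h1
    · have h3 : componentAxial G α h C ((e₁.trans θ').trans e₂.symm x).1 = α (θ (e₁ x).1).1 := by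
        have : e₂ (((e₁.trans θ').trans e₂.symm) x) = θ' (e₁ x) := by simp
        exact congrArg (fun z => α z.1.1) this
      rw [h3]
      exact h2 (e₁ x).1

theorem index_component (hα : IsAxialFunction G α) {h : Submodule ℝ g}
    (C : (subgraphOf G α h).ConnectedComponent) (p : C) (ξ : g) :
    index C.toSimpleGraph (componentAxial G α h C) ξ p =
      Nat.card {x : OutEdges G p.1 // restrictDual h (α x.1) = 0 ∧ α x.1 ξ < 0} := by
  refine Nat.card_congr (((componentOutEdgesEquiv hα C p).subtypeEquiv fun x => ?_).trans
    (Equiv.subtypeSubtypeEquivSubtypeInter _ fun x : OutEdges G p.1 => α x.1 ξ < 0))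
  exact Iff.rfl

theorem componentAxial_generic {h : Submodule ℝ g}
    (C : (subgraphOf G α h).ConnectedComponent) {ξ : g} (hξ : ξ ∈ generic G α) :
    ξ ∈ generic C.toSimpleGraph (componentAxial G α h C) :=
  fun _ => hξ _

end Components

/-! ### Upward paths inside a component -/

section Reachability

variable {V : Type*} [Finite V] {g : Type*} [AddCommGroup g] [Module ℝ g]
  {G : SimpleGraph V} {α : G.Dart → Module.Dual ℝ g} {ξ : g}

theorem wellFounded_up (hacyc : ∀ p, ¬ Relation.TransGen (Up G α ξ) p p) :
    WellFounded (Up G α ξ) := by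
  have : Std.Irrefl (Relation.TransGen (Up G α ξ)) := ⟨hacyc⟩
  have : IsTrans V (Relation.TransGen (Up G α ξ)) := ⟨fun _ _ _ => Relation.TransGen.trans⟩
  exact Subrelation.wf (fun h => Relation.TransGen.single h)
    (Finite.wellFounded_of_trans_of_irrefl (Relation.TransGen (Up G α ξ)))

/-- A vertex without downward edges in a component of `Γ_h` with zeroth Betti number `1` lies below
all other vertices of the component. -/
theorem reflTransGen_up_of_betti_eq_one (hα : IsAxialFunction G α)
    (hacyc : ∀ p, ¬ Relation.TransGen (Up G α ξ) p p) {h : Submodule ℝ g}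
    (C : (subgraphOf G α h).ConnectedComponent)
    (hC : betti C.toSimpleGraph (componentAxial G α h C) ξ 0 = 1) {p : V} (hp : p ∈ C.supp)
    (hmin : ∀ x : OutEdges G p, restrictDual h (α x.1) = 0 → ¬ α x.1 ξ < 0)
    {q : V} (hq : q ∈ C.supp) : Relation.ReflTransGen (Up G α ξ) p q := by
  have hzero : ∀ q : C, index C.toSimpleGraph (componentAxial G α h C) ξ q = 0 ↔
      ∀ x : OutEdges G q.1, restrictDual h (α x.1) = 0 → ¬ α x.1 ξ < 0 := by
    intro q
    rw [index_component hα, Finite.card_eq_zero_iff, isEmpty_subtype]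
    simp only [not_and]
  rw [betti, Nat.card_eq_one_iff_unique] at hC
  obtain ⟨hsub, -⟩ := hC
  -- Descend from `q` inside the component. The descent stops only at a vertex of index zero, and
  -- `p` is the only one.
  induction q using (wellFounded_up hacyc).induction with
  | _ q ih =>
    by_cases hdown : ∀ x : OutEdges G q, restrictDual h (α x.1) = 0 → ¬ α x.1 ξ < 0
    · have := hsub.elim ⟨⟨p, hp⟩, (hzero ⟨p, hp⟩).mpr hmin⟩ ⟨⟨q, hq⟩, (hzero ⟨q, hq⟩).mpr hdown⟩
      have hpq : p = q := congrArg (fun z => z.1.1) this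
      rw [hpq]
    · push Not at hdown
      obtain ⟨⟨d, rfl⟩, h0, hneg⟩ := hdown
      have hup : Up G α ξ d.snd d.fst := ⟨d.symm, rfl, rfl, by
        rw [hα.symm]
        simpa using hneg⟩
      have hq' : d.snd ∈ C.supp := (C.mem_supp_congr_adj (subgraphOf_adj hα h0)).mp hq
      exact (ih _ hup hq').tail hup

end Reachability

/-! ### Thom classes of components -/

section ThomClass

variable {V : Type*} [Finite V] {g : Type*} [AddCommGroup g] [Module ℝ g]
  {G : SimpleGraph V}

instance fintypeOutEdges (p : V) : Fintype (OutEdges G p) := Fintype.ofFinite _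

open Classical in
/-- The edges at `q` that do not belong to `Γ_h`. -/
def normalEdges (α : G.Dart → Module.Dual ℝ g) (h : Submodule ℝ g) (q : V) :
    Finset (OutEdges G q) :=
  {x | restrictDual h (α x.1) ≠ 0}

open Classical in
/-- The Thom class of a component `C` of `Γ_h`: it is supported on `C`, where it is the product of
the weights of the edges that do not belong to `Γ_h`. -/
def thomClass (α : G.Dart → Module.Dual ℝ g) (h : Submodule ℝ g)
    (C : (subgraphOf G α h).ConnectedComponent) (q : V) :
    SymmetricAlgebra ℝ (Module.Dual ℝ g) :=
  if q ∈ C.supp then ∏ x ∈ normalEdges α h q, linForm (α x.1) else 0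

variable {α : G.Dart → Module.Dual ℝ g}

theorem mem_normalEdges {h : Submodule ℝ g} {q : V} {x : OutEdges G q} :
    x ∈ normalEdges α h q ↔ restrictDual h (α x.1) ≠ 0 := by
  simp [normalEdges]

/-- As `h` lies in the kernel of `α d`, the matching along `d` preserves the edges of `Γ_h`, hence
also the normal ones. -/
theorem card_normalEdges_eq_and_restrictSym_prod_eq (hα : IsAxialFunction G α)
    {h : Submodule ℝ g} {d : G.Dart} (hd : restrictDual h (α d) = 0) :
    (normalEdges α h d.fst).card = (normalEdges α h d.snd).card ∧
      restrictSym (LinearMap.ker (α d)) (∏ x ∈ normalEdges α h d.fst, linForm (α x.1)) =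
      restrictSym (LinearMap.ker (α d)) (∏ x ∈ normalEdges α h d.snd, linForm (α x.1)) := by
  obtain ⟨θ, -, hθ⟩ := hα.compatible d
  have hmem : ∀ x, x ∈ normalEdges α h d.fst ↔ θ x ∈ normalEdges α h d.snd := fun x => by
    rw [mem_normalEdges, mem_normalEdges, Ne, Ne,
      restrictDual_eq_zero_iff_of_compatible hd (hθ x)]
  constructor
  · exact Finset.card_equiv θ hmem
  · rw [map_prod, map_prod]
    refine Finset.prod_equiv θ hmem fun x _ => ?_
    rw [restrictSym_linForm, restrictSym_linForm, hθ x]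

theorem card_normalEdges_eq_of_mem_supp (hα : IsAxialFunction G α) {h : Submodule ℝ g}
    {C : (subgraphOf G α h).ConnectedComponent} {p q : V} (hp : p ∈ C.supp) (hq : q ∈ C.supp) :
    (normalEdges α h p).card = (normalEdges α h q).card := by
  have hpq : (subgraphOf G α h).Reachable p q :=
    SimpleGraph.ConnectedComponent.exact (hp.trans hq.symm)
  obtain ⟨W⟩ := hpq
  clear hp hq
  induction W with
  | nil => rfl
  | cons hadj _ ih =>
    exact (card_normalEdges_eq_and_restrictSym_prod_eq hα (d := ⟨_, hadj.1⟩) hadj.2.1).1.trans ih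

/-- Along an edge of `Γ_h` the matching identifies the two products. For any other edge, its weight,
up to sign, is a factor at each end that lies in `C`, so both sides restrict to zero. -/
theorem restrictSym_thomClass (hα : IsAxialFunction G α) {h : Submodule ℝ g}
    (C : (subgraphOf G α h).ConnectedComponent) (d : G.Dart) :
    restrictSym (LinearMap.ker (α d)) (thomClass α h C d.fst) =
      restrictSym (LinearMap.ker (α d)) (thomClass α h C d.snd) := by
  by_cases hd : restrictDual h (α d) = 0
  · have hiff : d.fst ∈ C.supp ↔ d.snd ∈ C.supp := C.mem_supp_congr_adj (subgraphOf_adj hα hd)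
    rw [thomClass, thomClass]
    by_cases hC : d.fst ∈ C.supp
    · rw [if_pos hC, if_pos (hiff.mp hC)]
      exact (card_normalEdges_eq_and_restrictSym_prod_eq hα hd).2
    · rw [if_neg hC, if_neg (fun h' => hC (hiff.mpr h'))]
  · have hzero : ∀ d' : G.Dart, restrictDual h (α d') ≠ 0 →
        restrictSym (LinearMap.ker (α d')) (thomClass α h C d'.fst) = 0 := by
      intro d' hd'
      rw [thomClass]
      split_ifs
      · rw [map_prod]
        exact Finset.prod_eq_zero (i := ⟨d', rfl⟩) (mem_normalEdges.mpr hd')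
          (restrictSym_ker_self _)
      · exact map_zero _
    have hs := hzero d.symm (by rwa [hα.symm, map_neg, neg_ne_zero])
    rw [hα.symm] at hs
    have hker : LinearMap.ker (-α d) = LinearMap.ker (α d) := by
      ext x
      simp
    rw [hker] at hs
    rw [hzero d hd]
    exact hs.symm

theorem thomClass_mul_mem_cohomology (hα : IsAxialFunction G α) {h : Submodule ℝ g}
    {C : (subgraphOf G α h).ConnectedComponent} {p : V} (hp : p ∈ C.supp) {j : ℕ}
    {y : SymmetricAlgebra ℝ (Module.Dual ℝ g)} (hy : y ∈ symPow g j) :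
    (fun q => thomClass α h C q * y) ∈ cohomology G α (j + (normalEdges α h p).card) := by
  refine ⟨fun q => ?_, fun d => ?_⟩
  · dsimp only
    rw [thomClass]
    split_ifs with hq
    · rw [card_normalEdges_eq_of_mem_supp hα hp hq, add_comm j]
      exact mul_mem_symPow (prod_linForm_mem_symPow _ _) hy
    · rw [zero_mul]
      exact Submodule.zero_mem _
  · rw [map_mul, map_mul, restrictSym_thomClass hα]

end ThomClass

/-! ### Common kernels of few weights -/

section CommonKernel

variable {g : Type*} [AddCommGroup g] [Module ℝ g]

theorem finrank_quotient_iInf_ker_le {ι : Type*} (B : Finset ι) (w : ι → Module.Dual ℝ g) :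
    Module.finrank ℝ (g ⧸ ⨅ i : B, LinearMap.ker (w i)) ≤ B.card := by
  rw [← LinearMap.ker_pi, (LinearMap.quotKerEquivRange _).finrank_eq]
  refine (Submodule.finrank_le _).trans ?_
  simp

/-- A form vanishing on the common kernel lies in the span of the forms in `B`. Since `B` with one
more index has at most `l` members, independence excludes this for an index outside `B`. -/
theorem restrictDual_iInf_ker_eq_zero_iff {ι : Type*} {l : ℕ} {w : ι → Module.Dual ℝ g}
    (hw : LIndependent l w) {B : Finset ι} (hB : B.card < l) (x : ι) :
    restrictDual (⨅ i : B, LinearMap.ker (w i)) (w x) = 0 ↔ x ∈ B := by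
  classical
  rw [restrictDual_eq_zero_iff]
  constructor
  · intro hle
    by_contra hx
    have hspan := mem_span_of_iInf_ker_le_ker (L := fun i : B => w i) hle
    have hind : LinearIndepOn ℝ w (insert x B : Finset ι) :=
      hw (insert x B) ((Finset.card_insert_le _ _).trans hB)
    rw [Finset.coe_insert, linearIndepOn_insert (by simpa using hx)] at hind
    apply hind.2
    rwa [Set.image_eq_range]
  · intro hx
    exact iInf_le (fun i : B => LinearMap.ker (w i)) ⟨x, hx⟩

end CommonKernel

/-! ### Realising leading terms at a vertex -/

section LeadingTerms

variable {V : Type*} [Finite V] {g : Type*} [AddCommGroup g] [Module ℝ g]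
  {G : SimpleGraph V}

/-- The classes of degree `k` that vanish outside `A`. -/
def cohomologyOn (α : G.Dart → Module.Dual ℝ g) (k : ℕ) (A : Set V) :
    Submodule ℝ (V → SymmetricAlgebra ℝ (Module.Dual ℝ g)) :=
  cohomology G α k ⊓ Submodule.pi Aᶜ fun _ => ⊥

open Classical in
/-- The edges at `p` that descend with respect to `ξ`. -/
def downEdges (α : G.Dart → Module.Dual ℝ g) (ξ : g) (p : V) : Finset (OutEdges G p) :=
  {x | α x.1 ξ < 0}

/-- The forms `y` of degree `m` such that `y` times the product of the weights of the descending
edges at `p` is the value at `p` of a class supported on the vertices above `p`. -/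
def leadingTerms (α : G.Dart → Module.Dual ℝ g) (ξ : g) (p : V) (m : ℕ) :
    Submodule ℝ (SymmetricAlgebra ℝ (Module.Dual ℝ g)) :=
  symPow g m ⊓
    ((cohomologyOn α (m + index G α ξ p) {q | Relation.ReflTransGen (Up G α ξ) p q}).map
      (LinearMap.proj p)).comap
      (LinearMap.mulLeft ℝ (∏ x ∈ downEdges α ξ p, linForm (α x.1)))

variable {α : G.Dart → Module.Dual ℝ g} {ξ : g}

omit [Finite V] in
theorem mem_cohomologyOn {k : ℕ} {A : Set V}
    {f : V → SymmetricAlgebra ℝ (Module.Dual ℝ g)} :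
    f ∈ cohomologyOn α k A ↔ f ∈ cohomology G α k ∧ ∀ q, q ∉ A → f q = 0 := by
  simp [cohomologyOn, Submodule.mem_pi]

theorem mem_downEdges {p : V} {x : OutEdges G p} : x ∈ downEdges α ξ p ↔ α x.1 ξ < 0 := by
  simp [downEdges]

theorem card_downEdges (p : V) : (downEdges α ξ p).card = index G α ξ p := by
  classical
  rw [index, Nat.card_eq_fintype_card, Fintype.card_subtype]
  rfl

-- The witness is `y` times the Thom class of the component through `p` of `Γ_h`, with `h` the
-- common kernel of the weights in `B`. Its normal edges at `p` are the descending ones and the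
-- ascending ones outside `B`, and its support lies above `p`.
open Classical in
theorem prod_mul_mem_leadingTerms (hα : IsAxialFunction G α)
    (hacyc : ∀ p, ¬ Relation.TransGen (Up G α ξ) p p) {l : ℕ}
    (hβ : ∀ h : Submodule ℝ g, Module.finrank ℝ (g ⧸ h) < l →
      ∀ C : (subgraphOf G α h).ConnectedComponent,
        betti C.toSimpleGraph (componentAxial G α h C) ξ 0 = 1)
    {p : V} (hind : LIndependent l fun x : OutEdges G p => α x.1) {B : Finset (OutEdges G p)}
    (hB : B ⊆ (downEdges α ξ p)ᶜ) (hBl : B.card < l) (j : ℕ)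
    {y : SymmetricAlgebra ℝ (Module.Dual ℝ g)} (hy : y ∈ symPow g j) :
    (∏ x ∈ (downEdges α ξ p)ᶜ \ B, linForm (α x.1)) * y ∈
      leadingTerms α ξ p (j + ((downEdges α ξ p)ᶜ \ B).card) := by
  let h : Submodule ℝ g := ⨅ i : B, LinearMap.ker (α i.1.1)
  let C := (subgraphOf G α h).connectedComponentMk p
  have hp : p ∈ C.supp := rfl
  have hmem : ∀ x : OutEdges G p, restrictDual h (α x.1) = 0 ↔ x ∈ B :=
    restrictDual_iInf_ker_eq_zero_iff hind hBl
  have hnormal : normalEdges α h p = downEdges α ξ p ∪ ((downEdges α ξ p)ᶜ \ B) := by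
    ext x
    have hBx : x ∈ B → x ∉ downEdges α ξ p := fun hx => Finset.mem_compl.mp (hB hx)
    rw [mem_normalEdges, Ne, hmem, Finset.mem_union, Finset.mem_sdiff, Finset.mem_compl]
    tauto
  have hdisj : Disjoint (downEdges α ξ p) ((downEdges α ξ p)ᶜ \ B) :=
    Finset.disjoint_of_subset_right Finset.sdiff_subset disjoint_compl_right
  have hCβ := hβ h ((finrank_quotient_iInf_ker_le B fun x => α x.1).trans_lt hBl) C
  refine ⟨?_, fun q => thomClass α h C q * y, mem_cohomologyOn.mpr ⟨?_, fun q hq => ?_⟩, ?_⟩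
  · rw [add_comm]
    exact mul_mem_symPow (prod_linForm_mem_symPow _ _) hy
  · have := thomClass_mul_mem_cohomology hα hp hy
    rw [hnormal, Finset.card_union_of_disjoint hdisj, card_downEdges, add_comm (index G α ξ p),
      ← add_assoc] at this
    exact this
  · have hqC : q ∉ C.supp := fun hqC => hq (reflTransGen_up_of_betti_eq_one hα hacyc C hCβ hp
      (fun x hx hneg => Finset.mem_compl.mp (hB ((hmem x).mp hx)) (mem_downEdges.mpr hneg)) hqC)
    rw [thomClass, if_neg hqC, zero_mul]
  · change thomClass α h C p * y = _ * (_ * y)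
    rw [thomClass, if_pos hp, hnormal, Finset.prod_union hdisj, mul_assoc]

/-- In degree `m` the leading terms at `p` have small codimension. -/
theorem isBigO_codim_leadingTerms [FiniteDimensional ℝ g] (hα : IsAxialFunction G α)
    (hacyc : ∀ p, ¬ Relation.TransGen (Up G α ξ) p p) {l : ℕ}
    (hβ : ∀ h : Submodule ℝ g, Module.finrank ℝ (g ⧸ h) < l →
      ∀ C : (subgraphOf G α h).ConnectedComponent,
        betti C.toSimpleGraph (componentAxial G α h C) ξ 0 = 1)
    {p : V} (hind : LIndependent l fun x : OutEdges G p => α x.1) :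
    (fun m : ℕ => (Module.finrank ℝ (symPow g m) : ℝ) -
        Module.finrank ℝ (leadingTerms α ξ p m)) =O[atTop]
      (fun m : ℕ => (m : ℝ) ^ ((Module.finrank ℝ g : ℤ) - 1 - l)) := by
  classical
  exact isBigO_codim_of_prod_mem (downEdges α ξ p)ᶜ (fun x => α x.1) l
    (fun t _ ht => hind t ht) (leadingTerms α ξ p) (fun m => inf_le_left)
    (fun B hB hBl j y hy => prod_mul_mem_leadingTerms hα hacyc hβ hind hB hBl j hy)

end LeadingTerms

/-! ### Counting dimensions vertex by vertex -/

section MorseCounting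

variable {V : Type*} [Finite V] {g : Type*} [AddCommGroup g] [Module ℝ g]
  {G : SimpleGraph V} {α : G.Dart → Module.Dual ℝ g} {ξ : g}

instance finiteDimensional_cohomology [FiniteDimensional ℝ g] (k : ℕ) :
    FiniteDimensional ℝ (cohomology G α k) := by
  let F : cohomology G α k →ₗ[ℝ] (V → symPow g k) :=
    LinearMap.pi fun p => LinearMap.codRestrict _
      (LinearMap.proj p ∘ₗ (cohomology G α k).subtype) fun f => f.2.1 p
  refine FiniteDimensional.of_injective F fun f f' hff => ?_
  exact Subtype.ext (funext fun p => congrArg Subtype.val (congrFun hff p))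

instance finiteDimensional_cohomologyOn [FiniteDimensional ℝ g] (k : ℕ) (A : Set V) :
    FiniteDimensional ℝ (cohomologyOn α k A) :=
  Submodule.finiteDimensional_of_le (inf_le_left : _ ≤ cohomology G α k)

theorem prod_downEdges_ne_zero (hα : IsAxialFunction G α) (p : V) :
    ∏ x ∈ downEdges α ξ p, linForm (α x.1) ≠ 0 :=
  Finset.prod_ne_zero_iff.mpr fun _ _ => linForm_ne_zero (hα.ne_zero _)

/-- A class that vanishes at the vertices below `p` is divisible at `p` by the weights of the
descending edges. -/
theorem exists_eq_prod_downEdges_mul (hα : IsAxialFunction G α) {k : ℕ} {p : V}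
    (hk : index G α ξ p ≤ k) {f : V → SymmetricAlgebra ℝ (Module.Dual ℝ g)}
    (hf : f ∈ cohomology G α k) (hlow : ∀ q, Up G α ξ q p → f q = 0) :
    ∃ y ∈ symPow g (k - index G α ξ p),
      f p = (∏ x ∈ downEdges α ξ p, linForm (α x.1)) * y := by
  refine exists_eq_prod_mul (downEdges α ξ p) (fun x => α x.1) ?_ (fun x _ => hα.ne_zero _) ?_ ?_
  · intro x _ y _ hxy
    exact hα.pairwise_independent _ _ (x.2.trans y.2.symm) fun h => hxy (Subtype.ext h)
  · rw [card_downEdges, Nat.sub_add_cancel hk]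
    exact hf.1 p
  · rintro ⟨d, rfl⟩ hx
    have hneg := mem_downEdges.mp hx
    change restrictSym (LinearMap.ker (α d)) (f d.fst) = 0
    rw [hf.2 d, hlow d.snd ⟨d.symm, rfl, rfl, ?_⟩, map_zero]
    rw [hα.symm]
    simpa using hneg

variable [FiniteDimensional ℝ g]

/-- The dimension of the space of classes supported on an upward closed set of vertices is
computed by removing its minimal vertices one after the other. -/
theorem finrank_cohomologyOn_bounds (hα : IsAxialFunction G α)
    (hacyc : ∀ p, ¬ Relation.TransGen (Up G α ξ) p p) {k : ℕ} (hk : ∀ p, index G α ξ p ≤ k)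
    (A : Finset V) (hA : ∀ p ∈ A, ∀ q, Up G α ξ p q → q ∈ A) :
    ∑ p ∈ A, Module.finrank ℝ (leadingTerms α ξ p (k - index G α ξ p)) ≤
        Module.finrank ℝ (cohomologyOn α k (A : Set V)) ∧
      Module.finrank ℝ (cohomologyOn α k (A : Set V)) ≤
        ∑ p ∈ A, Module.finrank ℝ (symPow g (k - index G α ξ p)) := by
  classical
  induction hn : A.card generalizing A with
  | zero =>
    rw [Finset.card_eq_zero] at hn
    subst hn
    have : cohomologyOn α k ((∅ : Finset V) : Set V) = ⊥ := by
      rw [eq_bot_iff]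
      intro f hf
      exact funext fun q => (mem_cohomologyOn.mp hf).2 q (by simp)
    rw [this]
    simp
  | succ n ih =>
    have hne : A.Nonempty := Finset.card_pos.mp (by omega)
    obtain ⟨p, hp, hmin⟩ := (wellFounded_up hacyc).has_min (A : Set V) hne
    have hp : p ∈ A := hp
    have hup : ∀ a ∈ A.erase p, ∀ b, Up G α ξ a b → b ∈ A.erase p := by
      intro a ha b hab
      rw [Finset.mem_erase] at ha ⊢
      exact ⟨fun hb => hmin a ha.2 (hb ▸ hab), hA a ha.2 b hab⟩
    obtain ⟨ih1, ih2⟩ := ih (A.erase p) hup (by rw [Finset.card_erase_of_mem hp]; omega)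
    -- Rank-nullity for evaluation at the minimal vertex `p`: the kernel is the space for `A`
    -- without `p`, and the image is bounded on both sides.
    have hker : cohomologyOn α k (A : Set V) ⊓
        LinearMap.ker (LinearMap.proj p : (V → SymmetricAlgebra ℝ (Module.Dual ℝ g)) →ₗ[ℝ] _) =
        cohomologyOn α k (A.erase p : Set V) := by
      ext f
      rw [Submodule.mem_inf, mem_cohomologyOn, mem_cohomologyOn, LinearMap.mem_ker,
        LinearMap.proj_apply]
      constructor
      · rintro ⟨⟨h1, h2⟩, h3⟩
        refine ⟨h1, fun q hq => ?_⟩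
        by_cases hqp : q = p
        · rw [hqp, h3]
        · exact h2 q fun hqA => hq (by simpa [hqp] using hqA)
      · rintro ⟨h1, h2⟩
        exact ⟨⟨h1, fun q hq => h2 q fun h => hq (Finset.mem_of_mem_erase h)⟩, h2 p (by simp)⟩
    have hsum := finrank_map_add_finrank_inf_ker
      (LinearMap.proj p : (V → SymmetricAlgebra ℝ (Module.Dual ℝ g)) →ₗ[ℝ] _)
      (cohomologyOn α k (A : Set V))
    rw [hker] at hsum
    rw [← Finset.add_sum_erase A _ hp, ← Finset.add_sum_erase A _ hp, ← hsum]
    let μ := LinearMap.mulLeft ℝ (∏ x ∈ downEdges α ξ p, linForm (α x.1))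
    have hμ : Function.Injective μ := fun x y hxy =>
      mul_left_cancel₀ (prod_downEdges_ne_zero hα p) hxy
    constructor
    -- A class supported above `p` is supported on `A`, because `A` is upward closed.
    · refine add_le_add ?_ ih1
      rw [LinearEquiv.finrank_eq (Submodule.equivMapOfInjective μ hμ _)]
      apply Submodule.finrank_mono
      rintro _ ⟨y, ⟨-, f, hf, hfy⟩, rfl⟩
      rw [Nat.sub_add_cancel (hk p)] at hf
      have hf := mem_cohomologyOn.mp hf
      refine ⟨f, mem_cohomologyOn.mpr ⟨hf.1, fun q hq => hf.2 q fun hpq => hq ?_⟩, hfy⟩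
      clear hq hfy
      replace hpq : Relation.ReflTransGen (Up G α ξ) p q := hpq
      show q ∈ A
      induction hpq with
      | refl => exact hp
      | tail _ hab ih' => exact hA _ ih' _ hab
    -- By minimality the vertices directly below `p` lie outside `A`, so the class vanishes there
    -- and the divisibility lemma applies.
    · refine add_le_add ?_ ih2
      refine le_trans (Submodule.finrank_mono (t := (symPow g (k - index G α ξ p)).map μ) ?_)
        (Submodule.finrank_map_le _ _)
      rintro _ ⟨f, hf, rfl⟩
      have hf := mem_cohomologyOn.mp hf
      obtain ⟨y, hy, hfy⟩ := exists_eq_prod_downEdges_mul (ξ := ξ) hα (hk p) hf.1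
        fun q hq => hf.2 q fun hqA => hmin q hqA hq
      exact ⟨y, hy, hfy.symm⟩

end MorseCounting

/-! ### The asymptotic formula -/

section Total

variable {V : Type*} [Fintype V] {g : Type*} [AddCommGroup g] [Module ℝ g]
  {G : SimpleGraph V} {α : G.Dart → Module.Dual ℝ g} {ξ : g}

theorem finrank_cohomology_bounds [FiniteDimensional ℝ g] (hα : IsAxialFunction G α)
    (hacyc : ∀ p, ¬ Relation.TransGen (Up G α ξ) p p) {k : ℕ} (hk : ∀ p, index G α ξ p ≤ k) :
    ∑ p, Module.finrank ℝ (leadingTerms α ξ p (k - index G α ξ p)) ≤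
        Module.finrank ℝ (cohomology G α k) ∧
      Module.finrank ℝ (cohomology G α k) ≤
        ∑ p, Module.finrank ℝ (symPow g (k - index G α ξ p)) := by
  have := finrank_cohomologyOn_bounds hα hacyc hk Finset.univ fun _ _ q _ => Finset.mem_univ q
  have huniv : cohomologyOn α k ((Finset.univ : Finset V) : Set V) = cohomology G α k := by
    ext f
    simp [mem_cohomologyOn]
  rwa [huniv] at this

theorem sum_betti_mul_finrank {k : ℕ} (hk : ∀ p, index G α ξ p ≤ k) :
    ∑ r ∈ Finset.range (k + 1), (betti G α ξ r : ℝ) * (Module.finrank ℝ (symPow g (k - r)) : ℝ) =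
      ∑ p, (Module.finrank ℝ (symPow g (k - index G α ξ p)) : ℝ) := by
  classical
  rw [← Finset.sum_fiberwise_of_maps_to (s := Finset.univ) (t := Finset.range (k + 1))
    (g := fun p => index G α ξ p) fun p _ => Finset.mem_range.mpr (Nat.lt_succ_of_le (hk p))]
  refine Finset.sum_congr rfl fun r _ => ?_
  rw [Finset.sum_congr rfl (g := fun _ => (Module.finrank ℝ (symPow g (k - r)) : ℝ))
    fun p hp => by rw [(Finset.mem_filter.mp hp).2], Finset.sum_const, nsmul_eq_mul, betti,
    Nat.card_eq_fintype_card, Fintype.card_subtype]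

/-- The leading part of the Hilbert function of `H(Γ, α)` is given by the Betti numbers. -/
theorem isBigO_finrank_cohomology_sub [FiniteDimensional ℝ g] (hα : IsAxialFunction G α)
    (hnc : NoCycle G α) (hξ : ξ ∈ generic G α) {l : ℕ}
    (h₁ : ∀ h : Submodule ℝ g, Module.finrank ℝ (g ⧸ h) < l →
      ∀ C : (subgraphOf G α h).ConnectedComponent,
        betti C.toSimpleGraph (componentAxial G α h C) ξ 0 = 1)
    (h₂ : ∀ p : V, LIndependent l (fun x : OutEdges G p => α x.1)) :
    (fun k : ℕ => (Module.finrank ℝ (cohomology G α k) : ℝ) -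
        ∑ r ∈ Finset.range (k + 1), (betti G α ξ r : ℝ) *
          (Module.finrank ℝ (symPow g (k - r)) : ℝ))
      =O[atTop] (fun k : ℕ => (k : ℝ) ^ ((Module.finrank ℝ g : ℤ) - 1 - (l : ℤ))) := by
  obtain ⟨ζ, hζ, hacyc⟩ := hnc
  -- Invariance on each component carries the hypothesis from `ξ` to the acyclic `ζ`.
  have hβ : ∀ h : Submodule ℝ g, Module.finrank ℝ (g ⧸ h) < l →
      ∀ C : (subgraphOf G α h).ConnectedComponent,
        betti C.toSimpleGraph (componentAxial G α h C) ζ 0 = 1 := fun h hh C =>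
    (betti_eq_of_generic (isAxialFunction_componentAxial hα C) (componentAxial_generic C hζ)
      (componentAxial_generic C hξ) 0).trans (h₁ h hh C)
  have hO : (fun k : ℕ => ∑ p, ((Module.finrank ℝ (symPow g (k - index G α ζ p)) : ℝ) -
      Module.finrank ℝ (leadingTerms α ζ p (k - index G α ζ p)))) =O[atTop]
      (fun k : ℕ => (k : ℝ) ^ ((Module.finrank ℝ g : ℤ) - 1 - (l : ℤ))) :=
    IsBigO.fun_sum fun p _ => IsBigO.natCast_zpow_comp_sub
      (isBigO_codim_leadingTerms hα hacyc hβ (h₂ p)) (index G α ζ p)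
  refine IsBigO.trans (IsBigO.of_bound 1 ?_) hO
  -- The sum of the indices bounds each of them, so no subtraction `k - index G α ζ p` is truncated.
  filter_upwards [eventually_ge_atTop (∑ p, index G α ζ p)] with k hk
  have hk' : ∀ p, index G α ζ p ≤ k := fun p =>
    (Finset.single_le_sum (fun q _ => Nat.zero_le (index G α ζ q)) (Finset.mem_univ p)).trans hk
  simp only [betti_eq_of_generic hα hξ hζ]
  rw [sum_betti_mul_finrank hk']
  obtain ⟨hlow, hupp⟩ := finrank_cohomology_bounds hα hacyc hk'
  have hlow' : (∑ p, (Module.finrank ℝ (leadingTerms α ζ p (k - index G α ζ p)) : ℝ)) ≤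
      Module.finrank ℝ (cohomology G α k) := by exact_mod_cast hlow
  have hupp' : (Module.finrank ℝ (cohomology G α k) : ℝ) ≤
      ∑ p, (Module.finrank ℝ (symPow g (k - index G α ζ p)) : ℝ) := by exact_mod_cast hupp
  -- The upper bound is the Betti sum itself, so the error is at most the total codimension of the
  -- leading terms.
  rw [one_mul, Finset.sum_sub_distrib, Real.norm_eq_abs, Real.norm_eq_abs, abs_sub_comm,
    abs_of_nonneg (by linarith), abs_of_nonneg (by linarith)]
  linarith

end Total

end

end GraphAxial

theorem theorem2p6 {V : Type*} [Fintype V] {g : Type*} [AddCommGroup g] [Module ℝ g]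
    [FiniteDimensional ℝ g] (G : SimpleGraph V) [G.LocallyFinite] (d : ℕ)
    (hd : G.IsRegularOfDegree d) (α : G.Dart → Module.Dual ℝ g)
    (hα : GraphAxial.IsAxialFunction G α) (hnc : GraphAxial.NoCycle G α)
    (ξ : g) (hξ : ξ ∈ GraphAxial.generic G α) (l : ℕ)
    (h₁ : ∀ h : Submodule ℝ g, Module.finrank ℝ (g ⧸ h) < l →
      ∀ C : (GraphAxial.subgraphOf G α h).ConnectedComponent,
        GraphAxial.betti C.toSimpleGraph (GraphAxial.componentAxial G α h C) ξ 0 = 1)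
    (h₂ : ∀ p : V, GraphAxial.LIndependent l (fun x : GraphAxial.OutEdges G p => α x.1)) :
    (fun k : ℕ => (Module.finrank ℝ (GraphAxial.cohomology G α k) : ℝ) -
        ∑ r ∈ Finset.range (k + 1), (GraphAxial.betti G α ξ r : ℝ) *
          (Module.finrank ℝ (GraphAxial.symPow g (k - r)) : ℝ))
      =O[atTop] (fun k : ℕ => (k : ℝ) ^ ((Module.finrank ℝ g : ℤ) - 1 - (l : ℤ))) :=
  GraphAxial.isBigO_finrank_cohomology_sub hα hnc hξ h₁ h₂
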